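/- Let $\mathbb{F}$ be a field, let $N$ be an even natural number, and let $\mathbb{G}=\mathbb{F}(\mathcal{W})$ be the field of rational functions over $\mathbb{F}$ in the variables $\mathcal{W}=\{w_{i,k,j} : i,k,j\in\{1,\dots,N\}\}$. For integers $i\ge 1$, $j\ge i-1$ such that the interval $[i,j]\subseteq\{1,\dots,N\}$ has even length $j-i+1$, define $g_{i,j}\in\mathbb{G}[x_1,\dots,x_N]$ by $g_{i,j}=1$ if $[i,j]$ is empty, and otherwise \[ g_{i,j}=(1+x_ix_j)\,g_{i+1,j-1}+\sum_{k} w_{i,k,j}\,g_{i,k}\,g_{k+1,j}, \] where $k$ ranges over the integers $i+1\le k\le j-2$ for which $[i,k]$ has even length. Let $g=g_{1,N}$ (the Raz--Yehudayoff full-rank polynomial). An algebraic branching program (ABP) over $\mathbb{G}$ is a layered directed acyclic graph, with edges only between consecutive layers, each labelled by a variable $x_i$ or by an element of $\mathbb{G}$, with a start node in the first layer and a terminal node in the last layer; it computes the sum, over all paths from the start node to the terminal node, of the product of the edge labels along the path, and its size is its number of nodes. It is a read-once oblivious ABP (ROABP) if for every layer at most one variable labels the edges leaving that layer, and every variable appears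 as an edge label in at most one layer; the order in which the variables are read is arbitrary. There are absolute constants $\varepsilon>0$, $c>0$ and $N_0$ (independent of $\mathbb{F}$) such that, for every field $\mathbb{F}$ and every even $N\ge N_0$: if $g=f_1+\dots+f_m$, where every $f_i\in\mathbb{G}[x_1,\dots,x_N]$ is computed by an ROABP over $\mathbb{G}$ of size at most $s$ (different $f_i$ may use different variable orders), then \[ m\;\ge\;\frac{2^{\varepsilon N^{1/5}}}{s^{\,c\log_2 N}}. \] -/

import Mathlib

namespace ROABP

/-- An algebraic branching program over the field `K` in the variables `σ`: a layered directed
graph with layers `L_0, …, L_depth` (layer `i` consists of `width i` nodes), a start node in the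
first layer and a terminal node in the last one. Between a node `u` of layer `i` and a node `v` of
layer `i + 1` there is either no edge (`none`), or an edge labelled by a variable
(`some (Sum.inl x)`), or an edge labelled by a field constant (`some (Sum.inr a)`). -/
structure ABP (K : Type*) (σ : Type*) where
  depth : ℕ
  width : Fin (depth + 1) → ℕ
  edge : (i : Fin depth) → Fin (width i.castSucc) → Fin (width i.succ) → Option (σ ⊕ K)
  start : Fin (width 0)
  terminal : Fin (width (Fin.last depth))

namespace ABP

variable {K σ : Type*}

/-- The size of an ABP: its total number of nodes. -/
def size (P : ABP K σ) : ℕ := ∑ i, P.width i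

/-- The polynomial that labels an edge. A missing edge has weight `0`, so that a sequence of nodes
that is not a path contributes nothing to the sum over all paths. -/
noncomputable def labelPoly [CommSemiring K] : Option (σ ⊕ K) → MvPolynomial σ K
  | none => 0
  | some (Sum.inl x) => MvPolynomial.X x
  | some (Sum.inr a) => MvPolynomial.C a

/-- The polynomial computed by an ABP: the sum, over all paths from the start node to the terminal
node, of the product of the edge labels along the path. A path is given by its sequence of
nodes, one in every layer. -/
noncomputable def poly [CommSemiring K] (P : ABP K σ) : MvPolynomial σ K :=
  ∑ γ : ((i : Fin (P.depth + 1)) → Fin (P.width i)) with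
      γ 0 = P.start ∧ γ (Fin.last P.depth) = P.terminal,
    ∏ i : Fin P.depth, labelPoly (P.edge i (γ i.castSucc) (γ i.succ))

/-- The variable `x` labels an edge that leaves layer `i`. -/
def ReadsAt (P : ABP K σ) (i : Fin P.depth) (x : σ) : Prop :=
  ∃ u v, P.edge i u v = some (Sum.inl x)

/-- An ABP is oblivious if for every layer at most one variable labels edges from this layer. -/
def IsOblivious (P : ABP K σ) : Prop :=
  ∀ i x y, P.ReadsAt i x → P.ReadsAt i y → x = y

/-- A read-once oblivious ABP: an oblivious ABP in which each variable appears as an edge label in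
at most one layer. -/
def IsROABP (P : ABP K σ) : Prop :=
  P.IsOblivious ∧ ∀ x i j, P.ReadsAt i x → P.ReadsAt j x → i = j

end ABP

/-- The index set `[N] = {1, …, N}`. -/
abbrev Idx (N : ℕ) : Type := ↥(Finset.Icc 1 N)

/-- The field `𝔾 = F(W)` of rational functions over `F` in the variables
`W = {w_{i,k,j} : i, k, j ∈ [N]}`. -/
abbrev RatField (F : Type*) [Field F] (N : ℕ) : Type _ :=
  FractionRing (MvPolynomial (Idx N × Idx N × Idx N) F)

/-- The recursion that defines the full-rank polynomials `g_{i,j}` (for intervals `[i, j]` of even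
length), in an arbitrary commutative ring: `g_{i,j} = 1` for the empty interval, and otherwise
`g_{i,j} = (1 + x_i x_j) g_{i+1,j-1} + ∑_k w_{i,k,j} g_{i,k} g_{k+1,j}`, where the sum is over the
`k ∈ [i+1, j-2]` such that `[i, k]` has even length. -/
def gRec {R : Type*} [CommSemiring R] (x : ℕ → R) (w : ℕ → ℕ → ℕ → R) (i j : ℕ) : R :=
  if i ≤ j then
    (1 + x i * x j) * gRec x w (i + 1) (j - 1) +
      ∑ k : {k // k ∈ (Finset.Icc (i + 1) (j - 2)).filter (fun k => Even (k + 1 - i))},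
        w i k j * gRec x w i k * gRec x w (k + 1) j
  else 1
termination_by j + 1 - i
decreasing_by
  · omega
  · have := k.2
    simp only [Finset.mem_filter, Finset.mem_Icc] at this
    omega
  · have := k.2
    simp only [Finset.mem_filter, Finset.mem_Icc] at this
    omega

theorem gRec_of_lt {R : Type*} [CommSemiring R] (x : ℕ → R) (w : ℕ → ℕ → ℕ → R) {i j : ℕ}
    (h : j < i) : gRec x w i j = 1 := by
  rw [gRec, if_neg (by omega)]

theorem gRec_of_le {R : Type*} [CommSemiring R] (x : ℕ → R) (w : ℕ → ℕ → ℕ → R) {i j : ℕ}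
    (h : i ≤ j) : gRec x w i j = (1 + x i * x j) * gRec x w (i + 1) (j - 1) +
      ∑ k ∈ (Finset.Icc (i + 1) (j - 2)).filter (fun k => Even (k + 1 - i)),
        w i k j * gRec x w i k * gRec x w (k + 1) j := by
  rw [gRec, if_pos h]
  congr 1
  exact Finset.sum_coe_sort ((Finset.Icc (i + 1) (j - 2)).filter (fun k => Even (k + 1 - i)))
    (fun k => w i k j * gRec x w i k * gRec x w (k + 1) j)

/-- The variable `x_p` of `𝔾[X]`, `X = {x_1, …, x_N}` (only used for `p ∈ [N]`). -/
noncomputable def xVar (F : Type*) [Field F] (N : ℕ) (p : ℕ) :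
    MvPolynomial (Idx N) (RatField F N) :=
  if hp : p ∈ Finset.Icc 1 N then MvPolynomial.X ⟨p, hp⟩ else 0

/-- The element `w_{i,k,j}` of `𝔾`, as a constant of `𝔾[X]` (only used for `i, k, j ∈ [N]`). -/
noncomputable def wVar (F : Type*) [Field F] (N : ℕ) (i k j : ℕ) :
    MvPolynomial (Idx N) (RatField F N) :=
  if h : i ∈ Finset.Icc 1 N ∧ k ∈ Finset.Icc 1 N ∧ j ∈ Finset.Icc 1 N then
    MvPolynomial.C (algebraMap (MvPolynomial (Idx N × Idx N × Idx N) F) (RatField F N)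
      (MvPolynomial.X (⟨i, h.1⟩, ⟨k, h.2.1⟩, ⟨j, h.2.2⟩)))
  else 0

/-- The Raz–Yehudayoff full-rank polynomial `g = g_{1,N} ∈ 𝔾[x_1, …, x_N]`, for even `N`. -/
noncomputable def hardPoly (F : Type*) [Field F] (N : ℕ) :
    MvPolynomial (Idx N) (RatField F N) :=
  gRec (xVar F N) (wVar F N) 1 N

end ROABP

/-!
Call a polynomial of full rank for a partition `(Y, Z)` of its variables into halves if the matrix
of its coefficients at the square-free monomials `∏_{P'} x * ∏_{Q'} x`, `P' ⊆ Y`, `Q' ⊆ Z`, is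
invertible.

A cut of an ROABP of size `s` writes its polynomial as a sum of at most `s` products `A * B`, where
`A` only involves a prefix `V` of the variable order and `B` the other variables. Such a product
has a matrix of rank at most `2 ^ (#(Y ∩ V) + #(Z \ V))`, which is `2 ^ D` times smaller than full
rank if `#(Y ∩ V)` and `#(Z ∩ V)` differ by `D` in the right direction; exchanging the roles of `A`
and `B` takes care of the other direction. Hence if a sum of `m` ROABPs has full rank, either
`2 ^ D ≤ m * s` or `Y` is nearly balanced on all prefixes of one of the orders. The latter cannot
happen for all `Y` unless `m` is large: cut an order into `t` blocks of length `4 * D ^ 2`; given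
its trace on the earlier blocks, a set that is nearly balanced on all prefixes has one of `D` sizes
on the next block, and at most half of the subsets of the block have such a size, because
`2 * D * centralBinom (2 * D ^ 2) ≤ 2 ^ (4 * D ^ 2)`. So such sets are at most a fraction `2⁻ᵗ` of
all sets.

Conversely `g_{1,N}` has full rank for every balanced partition. As the coefficients are polynomials
in the parameters `w`, it suffices to find values of the parameters, in an infinite extension of the
field, for which this holds. If `[i, j]` splits into two shorter balanced intervals `[i, k]` and
`[k + 1, j]`, then `g_{i,j}` inherits full rank from its summand `w_{i,k,j} * g_{i,k} * g_{k+1,j}`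
for all but finitely many values of `w_{i,k,j}`; otherwise the partition separates `i` from `j`,
and for `w_{i,·,j} = 0` the factor `1 + x_i x_j` extends the full rank of `g_{i+1,j-1}`.
-/

namespace ROABP

open MvPolynomial Finset
open scoped Kronecker

section MatrixRank

variable {K m n p q : Type*} [Field K] [Fintype n] [Fintype q]

theorem rank_eq_card_iff_exists_left_inverse [Fintype m] [DecidableEq n] (M : Matrix m n K) :
    M.rank = Fintype.card n ↔ ∃ L : Matrix n m K, L * M = 1 := by
  classical
  constructor
  · intro hM
    have hker : LinearMap.ker M.mulVecLin = ⊥ := by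
      have := LinearMap.finrank_range_add_finrank_ker M.mulVecLin
      rw [Module.finrank_fintype_fun_eq_card, ← Matrix.rank, hM] at this
      exact Submodule.finrank_eq_zero.1 (by omega)
    obtain ⟨L, hL⟩ := M.mulVecLin.exists_leftInverse_of_injective hker
    refine ⟨LinearMap.toMatrix' L, ?_⟩
    rw [← LinearMap.toMatrix'_toLin' M, ← LinearMap.toMatrix'_comp, Matrix.toLin'_apply', hL,
      LinearMap.toMatrix'_id]
  · rintro ⟨L, hL⟩
    refine le_antisymm M.rank_le_card_width ?_
    calc Fintype.card n = (L * M).rank := by rw [hL, Matrix.rank_one]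
      _ ≤ M.rank := Matrix.rank_mul_le_right L M

theorem rank_eq_card_iff_det_ne_zero [DecidableEq n] (M : Matrix n n K) :
    M.rank = Fintype.card n ↔ M.det ≠ 0 := by
  rw [rank_eq_card_iff_exists_left_inverse, ← isUnit_iff_ne_zero, ← Matrix.isUnit_iff_isUnit_det]
  exact ⟨fun ⟨_, hL⟩ => .of_mul_eq_one_right _ hL, fun h => h.exists_left_inv⟩

theorem exists_det_smul_add_ne_zero [Infinite K] [DecidableEq n] {A : Matrix n n K}
    (hA : A.det ≠ 0) (B : Matrix n n K) : ∃ z : K, (z • A + B).det ≠ 0 := by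
  set d : Polynomial K :=
    ((Polynomial.X : Polynomial K) • A.map Polynomial.C + B.map Polynomial.C).det with hd
  have hd0 : d ≠ 0 := by
    intro h0
    apply hA
    rw [← Polynomial.coeff_det_X_add_C_card A B, ← hd, h0, Polynomial.coeff_zero]
  obtain ⟨z, hz⟩ := Polynomial.exists_eval_ne_zero_of_natDegree_lt_card d hd0
    (Cardinal.natCast_lt_aleph0.trans_le (Cardinal.aleph0_le_mk K))
  refine ⟨z, ?_⟩
  rw [← Polynomial.coe_evalRingHom, hd, RingHom.map_det] at hz
  convert hz
  ext
  simp [mul_comm z]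

theorem rank_kronecker_eq_card [Finite m] [Finite p] {A : Matrix m n K} {B : Matrix p q K}
    (hA : A.rank = Fintype.card n) (hB : B.rank = Fintype.card q) :
    (A ⊗ₖ B).rank = Fintype.card (n × q) := by
  classical
  have := Fintype.ofFinite m
  have := Fintype.ofFinite p
  rw [rank_eq_card_iff_exists_left_inverse] at *
  obtain ⟨L, hL⟩ := hA
  obtain ⟨M, hM⟩ := hB
  exact ⟨L ⊗ₖ M, by rw [← Matrix.mul_kronecker_mul, hL, hM, Matrix.one_kronecker_one]⟩

theorem rank_kronecker_le [Fintype m] (A : Matrix m n K) (B : Matrix p q K) :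
    (A ⊗ₖ B).rank ≤ Fintype.card m * Fintype.card q := by
  classical
  calc (A ⊗ₖ B).rank = ((1 : Matrix m m K) ⊗ₖ B * A ⊗ₖ (1 : Matrix q q K)).rank := by
        rw [← Matrix.mul_kronecker_mul, Matrix.one_mul, Matrix.mul_one]
    _ ≤ ((1 : Matrix m m K) ⊗ₖ B).rank := Matrix.rank_mul_le_left _ _
    _ ≤ Fintype.card (m × q) := Matrix.rank_le_card_width _
    _ = Fintype.card m * Fintype.card q := Fintype.card_prod m q

theorem rank_sum_le {ι : Type*} (s : Finset ι) (M : ι → Matrix m n K) :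
    (∑ i ∈ s, M i).rank ≤ ∑ i ∈ s, (M i).rank := by
  refine Finset.le_sum_of_subadditive (fun M : Matrix m n K => M.rank) Matrix.rank_zero.le
    (fun A B => ?_) s M
  rw [Matrix.rank, Matrix.mulVecLin_add]
  exact (Submodule.finrank_mono (LinearMap.range_add_le _ _)).trans
    (Submodule.finrank_add_le_finrank_add_finrank _ _)

end MatrixRank

section SquareFreeCoefficient

variable {σ R : Type*} [CommSemiring R]

/-- The coefficient in `f` of the square-free monomial `∏ i ∈ S, x_i`. These are the entries of the
partial derivative matrices. -/
noncomputable def sqCoeff (f : MvPolynomial σ R) (S : Finset σ) : R :=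
  coeff (∑ i ∈ S, Finsupp.single i 1) f

theorem sum_single_one_apply [DecidableEq σ] (S : Finset σ) (x : σ) :
    (∑ i ∈ S, Finsupp.single i 1 : σ →₀ ℕ) x = if x ∈ S then 1 else 0 := by
  simp [Finsupp.finsetSum_apply, Finsupp.single_apply]

theorem support_sum_single_one (S : Finset σ) :
    (∑ i ∈ S, Finsupp.single i 1 : σ →₀ ℕ).support = S := by
  classical
  ext x
  simp [sum_single_one_apply]

theorem sum_single_one_injective :
    Function.Injective fun S : Finset σ => (∑ i ∈ S, Finsupp.single i 1 : σ →₀ ℕ) :=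
  Function.LeftInverse.injective (g := Finsupp.support) support_sum_single_one

theorem sqCoeff_prod_X [DecidableEq σ] (S T : Finset σ) :
    sqCoeff (∏ i ∈ S, X i : MvPolynomial σ R) T = if S = T then 1 else 0 := by
  have hmonomial : (∏ i ∈ S, X i : MvPolynomial σ R) =
      monomial (∑ i ∈ S, Finsupp.single i 1) 1 := (monomial_sum_one S _).symm
  rw [sqCoeff, hmonomial, coeff_monomial]
  exact if_congr sum_single_one_injective.eq_iff rfl rfl

theorem sqCoeff_rename {τ : Type*} (v : σ ↪ τ) (f : MvPolynomial σ R) (S : Finset σ) :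
    sqCoeff (rename v f) (S.map v) = sqCoeff f S := by
  have hexp : ∑ i ∈ S.map v, Finsupp.single i 1 =
      (∑ i ∈ S, Finsupp.single i 1 : σ →₀ ℕ).mapDomain v := by
    simp [Finsupp.mapDomain_finsetSum, Finsupp.mapDomain_single]
  rw [sqCoeff, hexp, coeff_rename_mapDomain v v.injective, sqCoeff]

theorem support_subset_of_mem_supported {A : MvPolynomial σ R} {V : Set σ}
    (hA : A ∈ supported R V) {d : σ →₀ ℕ} (hd : coeff d A ≠ 0) : ↑d.support ⊆ V := by
  classical
  exact fun x hx => mem_supported.1 hA <|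
    mem_coe.2 <| (mem_vars_iff_mem_support x).2 ⟨d, mem_support_iff.2 hd, hx⟩

theorem eq_of_add_eq_add_of_support_subset {M : Type*} [AddCommMonoid M] {V W : Set σ}
    (hVW : Disjoint V W) {a a' b b' : σ →₀ M} (ha : ↑a.support ⊆ V) (ha' : ↑a'.support ⊆ V)
    (hb : ↑b.support ⊆ W) (hb' : ↑b'.support ⊆ W) (h : a + b = a' + b') : a = a' := by
  classical
  have filter_add_eq {c d : σ →₀ M} (hc : ↑c.support ⊆ V) (hd : ↑d.support ⊆ W) :
      (c + d).filter (· ∈ V) = c := by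
    rw [Finsupp.filter_add,
      (Finsupp.filter_eq_self_iff _ _).2 fun x hx => hc (Finsupp.mem_support_iff.2 hx),
      (Finsupp.filter_eq_zero_iff _ _).2 fun x hx => by_contra fun h0 =>
        hVW.notMem_of_mem_left hx (hd (Finsupp.mem_support_iff.2 h0)), add_zero]
  rw [← filter_add_eq ha hb, h, filter_add_eq ha' hb']

theorem coeff_add_mul_of_mem_supported {A B : MvPolynomial σ R} {V W : Set σ}
    (hVW : Disjoint V W) (hA : A ∈ supported R V) (hB : B ∈ supported R W) {a b : σ →₀ ℕ}
    (ha : ↑a.support ⊆ V) (hb : ↑b.support ⊆ W) :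
    coeff (a + b) (A * B) = coeff a A * coeff b B := by
  classical
  rw [coeff_mul]
  refine Finset.sum_eq_single (a, b) ?_ (by simp)
  rintro ⟨a', b'⟩ hab hne
  rw [HasAntidiagonal.mem_antidiagonal] at hab
  by_contra hcoeff
  have ha' := support_subset_of_mem_supported hA (left_ne_zero_of_mul hcoeff)
  have hb' := support_subset_of_mem_supported hB (right_ne_zero_of_mul hcoeff)
  obtain rfl : a' = a := eq_of_add_eq_add_of_support_subset hVW ha' ha hb' hb hab
  obtain rfl : b' = b := add_left_cancel hab
  exact hne rfl

theorem sqCoeff_mul [DecidableEq σ] {A B : MvPolynomial σ R} {V W : Set σ} (hVW : Disjoint V W)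
    (hA : A ∈ supported R V) (hB : B ∈ supported R W) {S T : Finset σ} (hS : ↑S ⊆ V)
    (hT : ↑T ⊆ W) : sqCoeff (A * B) (S ∪ T) = sqCoeff A S * sqCoeff B T := by
  have hST : Disjoint S T := disjoint_coe.1 (hVW.mono hS hT)
  rw [sqCoeff, sum_union hST, coeff_add_mul_of_mem_supported hVW hA hB, sqCoeff, sqCoeff]
  · rwa [support_sum_single_one]
  · rwa [support_sum_single_one]

end SquareFreeCoefficient

section PartialDerivativeMatrix

variable {σ : Type*} [DecidableEq σ]

/-- The subsets of a disjoint union are the pairs of subsets of the two parts. This is the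
identification of indices under which the partial derivative matrix of a product of polynomials in
disjoint sets of variables is a Kronecker product. -/
def powersetUnionEquiv {P Q : Finset σ} (h : Disjoint P Q) :
    P.powerset × Q.powerset ≃ (P ∪ Q).powerset where
  toFun S := ⟨S.1 ∪ S.2, by
    exact mem_powerset.2 (union_subset_union (mem_powerset.1 S.1.2) (mem_powerset.1 S.2.2))⟩
  invFun S := (⟨S ∩ P, mem_powerset.2 inter_subset_right⟩,
    ⟨S ∩ Q, mem_powerset.2 inter_subset_right⟩)
  left_inv := by
    rintro ⟨⟨S, hS⟩, ⟨T, hT⟩⟩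
    rw [mem_powerset] at hS hT
    ext x <;> grind [Finset.disjoint_left]
  right_inv := by
    rintro ⟨S, hS⟩
    ext x
    grind

/-- The partial derivative matrix of `f`: its rows are indexed by the subsets of `P`, its columns by
the subsets of `Q`, and its entries are the coefficients of the corresponding square-free
monomials. -/
noncomputable def pdMatrix {R : Type*} [CommSemiring R] (f : MvPolynomial σ R) (P Q : Finset σ) :
    Matrix P.powerset Q.powerset R :=
  Matrix.of fun S T => sqCoeff f (S ∪ T)

theorem pdMatrix_sum {R ι : Type*} [CommSemiring R] (s : Finset ι) (f : ι → MvPolynomial σ R)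
    (P Q : Finset σ) : pdMatrix (∑ i ∈ s, f i) P Q = ∑ i ∈ s, pdMatrix (f i) P Q := by
  ext
  simp [pdMatrix, sqCoeff, coeff_sum, Matrix.sum_apply]

theorem pdMatrix_C_mul_add {R : Type*} [CommSemiring R] (z : R) (f g : MvPolynomial σ R)
    (P Q : Finset σ) : pdMatrix (C z * f + g) P Q = z • pdMatrix f P Q + pdMatrix g P Q := by
  ext
  simp [pdMatrix, sqCoeff, coeff_C_mul]

theorem pdMatrix_map {R S : Type*} [CommSemiring R] [CommSemiring S] (φ : R →+* S)
    (f : MvPolynomial σ R) (P Q : Finset σ) :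
    pdMatrix (map φ f) P Q = (pdMatrix f P Q).map φ := by
  ext
  simp [pdMatrix, sqCoeff, coeff_map]

theorem pdMatrix_mul {R : Type*} [CommSemiring R] {A B : MvPolynomial σ R} {V W : Set σ}
    (hVW : Disjoint V W) (hA : A ∈ supported R V) (hB : B ∈ supported R W)
    {P₁ Q₁ P₂ Q₂ : Finset σ} (hP₁ : ↑P₁ ⊆ V) (hQ₁ : ↑Q₁ ⊆ V) (hP₂ : ↑P₂ ⊆ W) (hQ₂ : ↑Q₂ ⊆ W) :
    (pdMatrix (A * B) (P₁ ∪ P₂) (Q₁ ∪ Q₂)).submatrix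
        (powersetUnionEquiv (disjoint_coe.1 (hVW.mono hP₁ hP₂)))
        (powersetUnionEquiv (disjoint_coe.1 (hVW.mono hQ₁ hQ₂))) =
      pdMatrix A P₁ Q₁ ⊗ₖ pdMatrix B P₂ Q₂ := by
  have coe_union_subset {U : Set σ} {P Q : Finset σ} (hP : ↑P ⊆ U) (hQ : ↑Q ⊆ U)
      (S : P.powerset) (T : Q.powerset) : ((S ∪ T : Finset σ) : Set σ) ⊆ U := by
    rw [coe_union]
    exact Set.union_subset ((coe_subset.2 (mem_powerset.1 S.2)).trans hP)
      ((coe_subset.2 (mem_powerset.1 T.2)).trans hQ)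
  ext ⟨S₁, S₂⟩ ⟨T₁, T₂⟩
  calc sqCoeff (A * B) (S₁ ∪ S₂ ∪ (T₁ ∪ T₂))
      = sqCoeff (A * B) (S₁ ∪ T₁ ∪ (S₂ ∪ T₂)) := by rw [union_union_union_comm]
    _ = sqCoeff A (S₁ ∪ T₁) * sqCoeff B (S₂ ∪ T₂) :=
        sqCoeff_mul hVW hA hB (coe_union_subset hP₁ hQ₁ S₁ T₁) (coe_union_subset hP₂ hQ₂ S₂ T₂)

theorem det_pdMatrix_map {R S : Type*} [CommRing R] [CommRing S] (φ : R →+* S)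
    (f : MvPolynomial σ R) {P Q : Finset σ} (e : Q.powerset ≃ P.powerset) :
    ((pdMatrix (map φ f) P Q).submatrix e (Equiv.refl _)).det =
      φ ((pdMatrix f P Q).submatrix e (Equiv.refl _)).det := by
  rw [pdMatrix_map, RingHom.map_det]
  rfl

/-- The subsets of the image of `P` under `v` are the images of the subsets of `P`. This
identifies the partial derivative matrices before and after a renaming of the variables. -/
noncomputable def powersetMapEquiv {τ : Type*} (v : σ ↪ τ) (P : Finset σ) :
    P.powerset ≃ (P.map v).powerset :=
  .ofBijective (fun S => ⟨S.1.map v, mem_powerset.2 (map_subset_map.2 (mem_powerset.1 S.2))⟩)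
    ⟨fun _ _ h => Subtype.ext (map_injective v (congrArg Subtype.val h)), by
      rintro ⟨T, hT⟩
      obtain ⟨S, hS, rfl⟩ := subset_map_iff.1 (mem_powerset.1 hT)
      exact ⟨⟨S, mem_powerset.2 hS⟩, rfl⟩⟩

theorem pdMatrix_rename {R τ : Type*} [CommSemiring R] [DecidableEq τ] (v : σ ↪ τ)
    (f : MvPolynomial σ R) (P Q : Finset σ) :
    (pdMatrix (rename v f) (P.map v) (Q.map v)).submatrix
      (powersetMapEquiv v P) (powersetMapEquiv v Q) = pdMatrix f P Q := by
  ext S T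
  calc sqCoeff (rename v f) (S.1.map v ∪ T.1.map v)
      = sqCoeff (rename v f) ((S ∪ T : Finset σ).map v) := by rw [map_union]
    _ = sqCoeff f (S ∪ T) := sqCoeff_rename v f _

section Field

variable {K : Type*} [Field K]

/-- The partial derivative matrix of `f` has full column rank. For `#P = #Q`, it is then
invertible. -/
def FullRank (f : MvPolynomial σ K) (P Q : Finset σ) : Prop :=
  (pdMatrix f P Q).rank = 2 ^ #Q

theorem fullRank_iff_rank_eq_card {f : MvPolynomial σ K} {P Q : Finset σ} :
    FullRank f P Q ↔ (pdMatrix f P Q).rank = Fintype.card Q.powerset := by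
  rw [FullRank, Fintype.card_coe, card_powerset]

theorem FullRank.mul {A B : MvPolynomial σ K} {V W : Set σ} (hVW : Disjoint V W)
    (hA : A ∈ supported K V) (hB : B ∈ supported K W) {P₁ Q₁ P₂ Q₂ : Finset σ} (hP₁ : ↑P₁ ⊆ V)
    (hQ₁ : ↑Q₁ ⊆ V) (hP₂ : ↑P₂ ⊆ W) (hQ₂ : ↑Q₂ ⊆ W) (fA : FullRank A P₁ Q₁)
    (fB : FullRank B P₂ Q₂) : FullRank (A * B) (P₁ ∪ P₂) (Q₁ ∪ Q₂) := by
  rw [fullRank_iff_rank_eq_card] at *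
  rw [← Matrix.rank_submatrix _ (powersetUnionEquiv (disjoint_coe.1 (hVW.mono hP₁ hP₂)))
      (powersetUnionEquiv (disjoint_coe.1 (hVW.mono hQ₁ hQ₂))),
    pdMatrix_mul hVW hA hB hP₁ hQ₁ hP₂ hQ₂, rank_kronecker_eq_card fA fB]
  exact Fintype.card_congr (powersetUnionEquiv (disjoint_coe.1 (hVW.mono hQ₁ hQ₂)))

theorem rank_pdMatrix_mul_le {A B : MvPolynomial σ K} {V W : Set σ} (hVW : Disjoint V W)
    (hA : A ∈ supported K V) (hB : B ∈ supported K W) {P₁ Q₁ P₂ Q₂ : Finset σ} (hP₁ : ↑P₁ ⊆ V)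
    (hQ₁ : ↑Q₁ ⊆ V) (hP₂ : ↑P₂ ⊆ W) (hQ₂ : ↑Q₂ ⊆ W) :
    (pdMatrix (A * B) (P₁ ∪ P₂) (Q₁ ∪ Q₂)).rank ≤ 2 ^ (#P₁ + #Q₂) := by
  rw [← Matrix.rank_submatrix _ (powersetUnionEquiv (disjoint_coe.1 (hVW.mono hP₁ hP₂)))
      (powersetUnionEquiv (disjoint_coe.1 (hVW.mono hQ₁ hQ₂))),
    pdMatrix_mul hVW hA hB hP₁ hQ₁ hP₂ hQ₂]
  refine (rank_kronecker_le _ _).trans_eq ?_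
  rw [Fintype.card_coe, Fintype.card_coe, card_powerset, card_powerset, pow_add]

theorem fullRank_rename_iff {τ : Type*} [DecidableEq τ] (v : σ ↪ τ) (f : MvPolynomial σ K)
    (P Q : Finset σ) : FullRank (rename v f) (P.map v) (Q.map v) ↔ FullRank f P Q := by
  rw [FullRank, FullRank, card_map, ← pdMatrix_rename v f P Q, Matrix.rank_submatrix]

theorem fullRank_one : FullRank (1 : MvPolynomial σ K) ∅ ∅ := by
  have hone : pdMatrix (1 : MvPolynomial σ K) ∅ ∅ = 1 := by
    ext S T
    have hS : S.1 = ∅ := by simpa using S.2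
    have hT : T.1 = ∅ := by simpa using T.2
    obtain rfl : S = T := Subtype.ext (hS.trans hT.symm)
    calc sqCoeff (1 : MvPolynomial σ K) (S ∪ S) = 1 := by
          rw [hS]
          simpa using sqCoeff_prod_X (R := K) (∅ : Finset σ) ∅
      _ = (1 : Matrix _ _ K) S S := by rw [Matrix.one_apply_eq]
  rw [fullRank_iff_rank_eq_card, hone, Matrix.rank_one]

theorem sqCoeff_one_add_X_mul_X {i j : σ} (hij : i ≠ j) {S T : Finset σ} (hS : S ⊆ {i})
    (hT : T ⊆ {j}) :
    sqCoeff (1 + X i * X j : MvPolynomial σ K) (S ∪ T) = if i ∈ S ↔ j ∈ T then 1 else 0 := by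
  have hadd : sqCoeff (1 + X i * X j : MvPolynomial σ K) (S ∪ T) =
      (if ∅ = S ∪ T then 1 else 0) + if {i, j} = S ∪ T then 1 else 0 := by
    rw [← sqCoeff_prod_X, ← sqCoeff_prod_X, prod_pair hij, prod_empty]
    exact coeff_add _ _ _
  have hcard : #{i, j} = 2 := card_pair hij
  have hne : ∀ U : Finset σ, #U ≠ 2 → ({i, j} : Finset σ) ≠ U := fun U hU h => hU (h ▸ hcard)
  rw [hadd]
  rcases subset_singleton_iff.1 hS with rfl | rfl <;>
    rcases subset_singleton_iff.1 hT with rfl | rfl <;>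
    simp [hne, (insert_ne_empty i {j}).symm]

theorem fullRank_one_add_X_mul_X {i j : σ} (hij : i ≠ j) :
    FullRank (1 + X i * X j : MvPolynomial σ K) {i} {j} := by
  rw [fullRank_iff_rank_eq_card, rank_eq_card_iff_exists_left_inverse]
  let L : Matrix ({j} : Finset σ).powerset ({i} : Finset σ).powerset K :=
    Matrix.of fun T S => if i ∈ S.1 ↔ j ∈ T.1 then 1 else 0
  refine ⟨L, ?_⟩
  ext T T'
  have hentry (S : ({i} : Finset σ).powerset) (T : ({j} : Finset σ).powerset) :
      pdMatrix (1 + X i * X j : MvPolynomial σ K) {i} {j} S T =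
        if i ∈ S.1 ↔ j ∈ T.1 then 1 else 0 :=
    sqCoeff_one_add_X_mul_X hij (mem_powerset.1 S.2) (mem_powerset.1 T.2)
  have hTT' : T = T' ↔ (j ∈ T.1 ↔ j ∈ T'.1) := by
    rw [Subtype.ext_iff]
    rcases subset_singleton_iff.1 (mem_powerset.1 T.2) with h | h <;>
      rcases subset_singleton_iff.1 (mem_powerset.1 T'.2) with h' | h' <;> simp [h, h', eq_comm]
  have hpow : ({i} : Finset σ).powerset = {∅, {i}} := by
    ext S
    simp [subset_singleton_iff]
  calc (L * pdMatrix (1 + X i * X j : MvPolynomial σ K) {i} {j}) T T'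
      = ∑ S : ({i} : Finset σ).powerset, (if i ∈ S.1 ↔ j ∈ T.1 then 1 else 0) *
          if i ∈ S.1 ↔ j ∈ T'.1 then 1 else 0 :=
        Matrix.mul_apply.trans <| sum_congr rfl fun S _ => congrArg (L T S * ·) (hentry S T')
    _ = ∑ S ∈ ({i} : Finset σ).powerset, (if i ∈ S ↔ j ∈ T.1 then 1 else 0) *
          if i ∈ S ↔ j ∈ T'.1 then (1 : K) else 0 :=
        sum_coe_sort ({i} : Finset σ).powerset fun S =>
          (if i ∈ S ↔ j ∈ T.1 then 1 else 0) * if i ∈ S ↔ j ∈ T'.1 then (1 : K) else 0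
    _ = (1 : Matrix _ _ K) T T' := by
        rw [hpow, sum_pair (singleton_ne_empty i).symm, Matrix.one_apply]
        by_cases hT : j ∈ T.1 <;> by_cases hT' : j ∈ T'.1 <;> simp [hTT', hT, hT']

theorem exists_powerset_equiv {α : Type*} {P Q : Finset α} (h : #P = #Q) :
    Nonempty (Q.powerset ≃ P.powerset) := by
  rw [← Fintype.card_eq, Fintype.card_coe, Fintype.card_coe, card_powerset, card_powerset, h]

theorem fullRank_iff_det_ne_zero (f : MvPolynomial σ K) {P Q : Finset σ}
    (e : Q.powerset ≃ P.powerset) :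
    FullRank f P Q ↔ ((pdMatrix f P Q).submatrix e (Equiv.refl _)).det ≠ 0 := by
  rw [fullRank_iff_rank_eq_card, ← rank_eq_card_iff_det_ne_zero, Matrix.rank_submatrix]

theorem FullRank.exists_C_mul_add [Infinite K] {A : MvPolynomial σ K} {P Q : Finset σ}
    (hA : FullRank A P Q) (h : #P = #Q) (B : MvPolynomial σ K) :
    ∃ z : K, FullRank (C z * A + B) P Q := by
  obtain ⟨e⟩ := exists_powerset_equiv h
  rw [fullRank_iff_det_ne_zero A e] at hA
  obtain ⟨z, hz⟩ := exists_det_smul_add_ne_zero hA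
    ((pdMatrix B P Q).submatrix e (Equiv.refl _))
  exact ⟨z, (fullRank_iff_det_ne_zero _ e).2 (by rwa [pdMatrix_C_mul_add])⟩

theorem FullRank.map_of_injective {R L : Type*} [CommRing R] [Field L] {f : MvPolynomial σ R}
    {P Q : Finset σ} {φ : R →+* L} (hf : FullRank (map φ f) P Q) (h : #P = #Q) {ψ : R →+* K}
    (hψ : Function.Injective ψ) : FullRank (map ψ f) P Q := by
  obtain ⟨e⟩ := exists_powerset_equiv h
  rw [fullRank_iff_det_ne_zero _ e, det_pdMatrix_map] at hf ⊢
  rw [map_ne_zero_iff ψ hψ]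
  exact fun h0 => hf (by rw [h0, map_zero])

end Field

end PartialDerivativeMatrix


section PathSum

variable {A : Type*} [CommSemiring A] {n : ℕ}

/-- The sum over all paths `γ` through the layers `α 0, …, α n` of the product of the edge labels
`e` along `γ`, with a weight `a` for its first node and a weight `b` for its last one. The weights
make the sum stable under removing the first layer, and indicator functions as weights select the
paths between two given nodes. -/
def pathSum {α : Fin (n + 1) → Type*} [∀ i, Fintype (α i)]
    (e : (i : Fin n) → α i.castSucc → α i.succ → A) (a : α 0 → A) (b : α (Fin.last n) → A) : A :=
  ∑ γ : (i : Fin (n + 1)) → α i,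
    a (γ 0) * (∏ i : Fin n, e i (γ i.castSucc) (γ i.succ)) * b (γ (Fin.last n))

theorem pathSum_eq_sum_mul_single {α : Fin (n + 1) → Type*} [∀ i, Fintype (α i)]
    [DecidableEq (α 0)] (e : (i : Fin n) → α i.castSucc → α i.succ → A) (a : α 0 → A)
    (b : α (Fin.last n) → A) :
    pathSum e a b = ∑ u, a u * pathSum e (Pi.single u 1) b := by
  simp only [pathSum, mul_sum]
  rw [sum_comm]
  refine sum_congr rfl fun γ _ => ?_
  rw [Fintype.sum_eq_single (γ 0) fun u hu => by simp [Pi.single_eq_of_ne hu.symm],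
    Pi.single_eq_same, one_mul, mul_assoc]

theorem pathSum_succ {α : Fin (n + 2) → Type*} [∀ i, Fintype (α i)]
    (e : (i : Fin (n + 1)) → α i.castSucc → α i.succ → A) (a : α 0 → A)
    (b : α (Fin.last (n + 1)) → A) :
    pathSum e a b =
      pathSum (α := fun i => α i.succ) (fun i => e i.succ) (fun v => ∑ u, a u * e 0 u v) b := by
  simp only [pathSum, sum_mul]
  rw [sum_comm, ← Fintype.sum_prod_type', ← (Fin.consEquiv α).sum_comp]
  refine sum_congr rfl fun γ _ => ?_
  rw [Fin.prod_univ_succ, ← mul_assoc]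
  rfl

variable {R : Type*} [CommSemiring R] [Algebra R A]

theorem pathSum_mem {α : Fin (n + 1) → Type*} [∀ i, Fintype (α i)] {T : Subalgebra R A}
    {e : (i : Fin n) → α i.castSucc → α i.succ → A} {a : α 0 → A} {b : α (Fin.last n) → A}
    (he : ∀ i u v, e i u v ∈ T) (ha : ∀ u, a u ∈ T) (hb : ∀ u, b u ∈ T) :
    pathSum e a b ∈ T :=
  sum_mem fun _ _ => mul_mem (mul_mem (ha _) (prod_mem fun _ _ => he _ _ _)) (hb _)

theorem exists_pathSum_eq_sum_mul {α : Fin (n + 1) → Type*} [∀ i, Fintype (α i)]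
    {e : (i : Fin n) → α i.castSucc → α i.succ → A} {a : α 0 → A} {b : α (Fin.last n) → A}
    (l : Fin (n + 1)) {T₁ T₂ : Subalgebra R A} (ha : ∀ u, a u ∈ T₁) (hb : ∀ u, b u ∈ T₂)
    (he₁ : ∀ i : Fin n, (i : ℕ) < l → ∀ u v, e i u v ∈ T₁)
    (he₂ : ∀ i : Fin n, (l : ℕ) ≤ i → ∀ u v, e i u v ∈ T₂) :
    ∃ f g : α l → A, (∀ u, f u ∈ T₁) ∧ (∀ u, g u ∈ T₂) ∧ pathSum e a b = ∑ u, f u * g u := by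
  classical
  obtain ⟨l, hl⟩ := l
  induction l generalizing n with
  | zero =>
    have hsingle (u v : α 0) : (Pi.single u 1 : α 0 → A) v ∈ T₂ := by
      rw [Pi.single_apply]
      split_ifs
      exacts [one_mem _, zero_mem _]
    exact ⟨a, fun u => pathSum e (Pi.single u 1) b, ha,
      fun u => pathSum_mem (fun i => he₂ i (Nat.zero_le _)) (hsingle u) hb,
      pathSum_eq_sum_mul_single e a b⟩
  | succ l ih =>
    obtain ⟨n, rfl⟩ : ∃ n', n = n' + 1 := Nat.exists_eq_succ_of_ne_zero (by omega)
    have ha' (v) : ∑ u, a u * e 0 u v ∈ T₁ :=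
      sum_mem fun u _ => mul_mem (ha u) (he₁ 0 (Nat.succ_pos _) u v)
    rw [pathSum_succ]
    exact ih (α := fun i => α i.succ) (e := fun i => e i.succ) ha' hb (Nat.succ_lt_succ_iff.1 hl)
      (fun i hi => he₁ i.succ (Nat.succ_lt_succ hi))
      fun i hi => he₂ i.succ (Nat.succ_le_succ hi)

end PathSum

section Cut

variable {K σ : Type*}

theorem ABP.width_le_size (P : ABP K σ) (l : Fin (P.depth + 1)) :
    P.width l ≤ P.size :=
  single_le_sum (fun _ _ => Nat.zero_le _) (mem_univ l)

theorem ABP.size_pos (P : ABP K σ) : 0 < P.size :=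
  P.start.pos.trans_le (P.width_le_size 0)

theorem ABP.IsROABP.exists_injective_readsAt [Finite σ] {P : ABP K σ} (hP : P.IsROABP) :
    ∃ key : σ → ℕ, Function.Injective key ∧ ∀ i x, P.ReadsAt i x → key x = i := by
  classical
  have := Fintype.ofFinite σ
  have hex : ∀ x, ∃ l : ℕ, ∀ i, P.ReadsAt i x → l = i := by
    intro x
    by_cases h : ∃ i, P.ReadsAt i x
    · exact h.imp' _ fun i hi j hj => congrArg _ (hP.2 x i j hi hj)
    · exact ⟨0, fun i hi => (h ⟨i, hi⟩).elim⟩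
  choose layer hlayer using hex
  have hinj : Set.InjOn layer {x | ∃ i, P.ReadsAt i x} := by
    rintro x ⟨i, hi⟩ y ⟨j, hj⟩ hxy
    obtain rfl : i = j := Fin.ext (by rw [← hlayer x i hi, hxy, hlayer y j hj])
    exact hP.1 i x y hi hj
  obtain ⟨t, hlt, ht⟩ := Infinite.exists_superset_card_eq (univ.image layer) (Fintype.card σ)
    card_image_le
  obtain ⟨g, hg⟩ := Set.MapsTo.exists_equiv_extend_of_card_eq ht.symm
    (fun x _ => hlt (mem_image_of_mem layer (mem_univ x))) hinj
  exact ⟨fun x => g x, Subtype.val_injective.comp g.injective,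
    fun i x hx => (hg x ⟨i, hx⟩).trans (hlayer x i hx)⟩

variable [CommSemiring K]

/-- The polynomial `f` is a sum of at most `s` products of a polynomial in the variables from `V`
and a polynomial in the remaining variables. -/
def HasCutRankLE (f : MvPolynomial σ K) (V : Set σ) (s : ℕ) : Prop :=
  ∃ w ≤ s, ∃ A B : Fin w → MvPolynomial σ K,
    (∀ u, A u ∈ supported K V) ∧ (∀ u, B u ∈ supported K Vᶜ) ∧ f = ∑ u, A u * B u

theorem HasCutRankLE.compl {f : MvPolynomial σ K} {V : Set σ} {s : ℕ}
    (h : HasCutRankLE f V s) : HasCutRankLE f Vᶜ s := by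
  obtain ⟨w, hw, A, B, hA, hB, rfl⟩ := h
  exact ⟨w, hw, B, A, hB, by rwa [compl_compl], sum_congr rfl fun u _ => mul_comm _ _⟩

theorem HasCutRankLE.mono {f : MvPolynomial σ K} {V : Set σ} {s t : ℕ}
    (h : HasCutRankLE f V s) (hst : s ≤ t) : HasCutRankLE f V t :=
  h.imp fun _ h => ⟨h.1.trans hst, h.2⟩

namespace ABP

theorem labelPoly_edge_mem_supported (P : ABP K σ) {i : Fin P.depth} {V : Set σ}
    (hV : ∀ x, P.ReadsAt i x → x ∈ V) (u v) : labelPoly (P.edge i u v) ∈ supported K V := by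
  rcases h : P.edge i u v with _ | x | c
  · exact zero_mem _
  · exact Algebra.subset_adjoin ⟨x, hV x ⟨u, v, h⟩, rfl⟩
  · exact Subalgebra.algebraMap_mem _ c

theorem poly_eq_pathSum (P : ABP K σ) :
    P.poly = pathSum (α := fun i => Fin (P.width i)) (fun i u v => labelPoly (P.edge i u v))
      (Pi.single P.start 1) (Pi.single P.terminal 1) := by
  rw [poly, pathSum, sum_filter]
  refine sum_congr rfl fun γ _ => ?_
  by_cases hs : γ 0 = P.start <;> by_cases ht : γ (Fin.last P.depth) = P.terminal <;>
    simp [hs, ht]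

theorem hasCutRankLE (P : ABP K σ) (l : Fin (P.depth + 1)) {V : Set σ}
    (hV : ∀ i : Fin P.depth, ∀ x, P.ReadsAt i x → (x ∈ V ↔ (i : ℕ) < l)) :
    HasCutRankLE P.poly V P.size := by
  have hsingle {w : ℕ} (u v : Fin w) (W : Set σ) :
      (Pi.single u 1 : Fin w → MvPolynomial σ K) v ∈ supported K W := by
    rw [Pi.single_apply]
    split_ifs
    exacts [one_mem _, zero_mem _]
  obtain ⟨f, g, hf, hg, hfg⟩ := exists_pathSum_eq_sum_mul (R := K)
    (α := fun i => Fin (P.width i)) (e := fun i u v => labelPoly (P.edge i u v)) l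
    (fun u => hsingle P.start u V) (fun u => hsingle P.terminal u Vᶜ)
    (fun i hi => P.labelPoly_edge_mem_supported fun x hx => (hV i x hx).2 hi)
    fun i hi => P.labelPoly_edge_mem_supported fun x hx hxV => hi.not_gt ((hV i x hx).1 hxV)
  exact ⟨P.width l, P.width_le_size l, f, g, hf, hg, P.poly_eq_pathSum.trans hfg⟩

theorem IsROABP.exists_injective_hasCutRankLE [Finite σ] {P : ABP K σ} (hP : P.IsROABP) :
    ∃ key : σ → ℕ, Function.Injective key ∧ ∀ l, HasCutRankLE P.poly {x | key x < l} P.size := by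
  obtain ⟨key, hkey, hread⟩ := hP.exists_injective_readsAt
  refine ⟨key, hkey, fun l => ?_⟩
  refine P.hasCutRankLE ⟨min l P.depth, Nat.lt_succ_of_le (min_le_right _ _)⟩ fun i x hx => ?_
  rw [Set.mem_ofPred_eq, hread i x hx, lt_min_iff, and_iff_left i.2]

end ABP

end Cut

section CentralBinom

theorem sq_centralBinom_mul_le (a : ℕ) : a.centralBinom ^ 2 * (2 * a + 1) ≤ 16 ^ a := by
  induction a with
  | zero => simp
  | succ a ih =>
    refine Nat.le_of_mul_le_mul_left ?_ (pow_pos a.succ_pos 2)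
    calc (a + 1) ^ 2 * ((a + 1).centralBinom ^ 2 * (2 * (a + 1) + 1))
        = ((a + 1) * (a + 1).centralBinom) ^ 2 * (2 * a + 3) := by ring
      _ = 4 * ((2 * a + 1) * (2 * a + 3)) * (a.centralBinom ^ 2 * (2 * a + 1)) := by
          rw [Nat.succ_mul_centralBinom_succ]
          ring
      _ ≤ 4 * (4 * (a + 1) ^ 2) * 16 ^ a := by
          refine Nat.mul_le_mul (Nat.mul_le_mul_left 4 ?_) ih
          nlinarith
      _ = (a + 1) ^ 2 * 16 ^ (a + 1) := by ring

theorem two_mul_mul_centralBinom_le (D : ℕ) :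
    2 * (D * (2 * D ^ 2).centralBinom) ≤ 2 ^ (4 * D ^ 2) := by
  rw [← Nat.pow_le_pow_iff_left (n := 2) two_ne_zero]
  calc (2 * (D * (2 * D ^ 2).centralBinom)) ^ 2
      = (2 * D ^ 2).centralBinom ^ 2 * (4 * D ^ 2) := by ring
    _ ≤ (2 * D ^ 2).centralBinom ^ 2 * (2 * (2 * D ^ 2) + 1) := by
        gcongr
        omega
    _ ≤ 16 ^ (2 * D ^ 2) := sq_centralBinom_mul_le _
    _ = (2 ^ (4 * D ^ 2)) ^ 2 := by
        rw [show 16 = 2 ^ 4 by norm_num, ← pow_mul, ← pow_mul]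
        ring_nf

end CentralBinom

section NearlyBalanced

variable {σ : Type*}

theorem card_filter_powerset_abs_lt_le (B : Finset σ) {a : ℕ} (hB : #B = 2 * a) (D : ℕ)
    (r c : ℤ) : #{T ∈ B.powerset | |2 * (r + #T) - c| < D} ≤ D * a.centralBinom := by
  classical
  set J : Finset ℤ := Icc ((c - D - 2 * r) / 2 + 1) ((c - D - 2 * r) / 2 + D) with hJ
  have hJcard : #J = D := by simp [hJ]
  calc #{T ∈ B.powerset | |2 * (r + #T) - c| < D}
      ≤ #(J.biUnion fun j => B.powersetCard j.toNat) := by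
        refine card_le_card fun T hT => ?_
        obtain ⟨hTB, hT⟩ := mem_filter.1 hT
        have hTJ : (#T : ℤ) ∈ J := by
          rw [hJ, mem_Icc]
          rw [abs_lt] at hT
          omega
        exact mem_biUnion.2 ⟨#T, hTJ, mem_powersetCard.2 ⟨mem_powerset.1 hTB, rfl⟩⟩
    _ ≤ #J * a.centralBinom := by
        refine card_biUnion_le_card_mul _ _ _ fun j _ => ?_
        rw [card_powersetCard, hB]
        exact Nat.choose_le_centralBinom _ _
    _ = D * a.centralBinom := by rw [hJcard]

theorem subset_of_monotone_of_card_le {ι : Type*} [LinearOrder ι] {S : ι → Finset σ}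
    (hS : Monotone S) {i j : ι} (h : #(S i) ≤ #(S j)) : S i ⊆ S j := by
  rcases le_total i j with hij | hij
  · exact hS hij
  · exact (eq_of_subset_of_card_le (hS hij) h).superset

theorem exists_card_sublevel_eq [Fintype σ] {key : σ → ℕ} (hkey : Function.Injective key)
    {k : ℕ} (hk : k ≤ Fintype.card σ) : ∃ l, #{x | key x < l} = k := by
  classical
  induction k with
  | zero => exact ⟨0, by simp⟩
  | succ k ih =>
    obtain ⟨l, hl⟩ := ih (by omega)
    have hne : (({x | key x < l} : Finset σ)ᶜ).Nonempty := by
      rw [← card_pos, card_compl]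
      omega
    obtain ⟨x, hx, hmin⟩ := exists_min_image _ key hne
    have hxl : l ≤ key x := by simpa using hx
    refine ⟨key x + 1, ?_⟩
    have hinsert : ({y | key y < key x + 1} : Finset σ) =
        insert x ({y | key y < l} : Finset σ) := by
      ext y
      have hy : ¬ key y < l → key x ≤ key y := by simpa using hmin y
      have := @hkey y x
      simp only [mem_filter_univ, mem_insert]
      grind
    rw [hinsert, card_insert_of_notMem (by simpa using hxl), hl]

theorem two_pow_le_card_mul_card_of_cover [Fintype σ] {ι : Type*} [Fintype ι] {t : ℕ}
    (hσ : Even (Fintype.card σ)) (hσ₀ : 0 < Fintype.card σ) {𝒴 : ι → Finset (Finset σ)}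
    (h𝒴 : ∀ i, 2 ^ t * #(𝒴 i) ≤ 2 ^ Fintype.card σ)
    (hcover : ∀ Y : Finset σ, 2 * #Y = Fintype.card σ → ∃ i, Y ∈ 𝒴 i) :
    2 ^ t ≤ Fintype.card ι * Fintype.card σ := by
  classical
  obtain ⟨n, hn⟩ := even_iff_exists_two_mul.1 hσ
  have hbinom : n.centralBinom ≤ ∑ i, #(𝒴 i) := by
    calc n.centralBinom = #(powersetCard n (univ : Finset σ)) := by
          rw [card_powersetCard, card_univ, Nat.centralBinom, hn]
      _ ≤ #(univ.biUnion 𝒴) := card_le_card fun Y hY => by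
          obtain ⟨i, hi⟩ := hcover Y (by rw [(mem_powersetCard.1 hY).2, hn])
          exact mem_biUnion.2 ⟨i, mem_univ _, hi⟩
      _ ≤ ∑ i, #(𝒴 i) := card_biUnion_le
  have hpow : 2 ^ Fintype.card σ ≤ Fintype.card σ * n.centralBinom := by
    rw [hn, pow_mul]
    exact Nat.four_pow_le_two_mul_self_mul_centralBinom n (by omega)
  refine Nat.le_of_mul_le_mul_right ?_ n.centralBinom_pos
  calc 2 ^ t * n.centralBinom ≤ ∑ i, 2 ^ t * #(𝒴 i) := by
        rw [← mul_sum]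
        gcongr
    _ ≤ ∑ _i : ι, 2 ^ Fintype.card σ := sum_le_sum fun i _ => h𝒴 i
    _ = Fintype.card ι * 2 ^ Fintype.card σ := by simp
    _ ≤ Fintype.card ι * (Fintype.card σ * n.centralBinom) := by gcongr
    _ = Fintype.card ι * Fintype.card σ * n.centralBinom := (mul_assoc _ _ _).symm

variable [DecidableEq σ]

theorem card_filter_powerset_le_mul {U V : Finset σ} {p q : Finset σ → Prop} [DecidablePred p]
    [DecidablePred q] {M : ℕ} (hp : ∀ Y, q Y → p (Y ∩ U))
    (hM : ∀ Y ⊆ U, #{T ∈ (V \ U).powerset | q (Y ∪ T)} ≤ M) :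
    #{Y ∈ V.powerset | q Y} ≤ M * #{Y ∈ U.powerset | p Y} := by
  refine card_le_mul_card_image_of_maps_to (f := (· ∩ U)) (fun Y hY => ?_) M fun Y hY => ?_
  · exact mem_filter.2 ⟨mem_powerset.2 inter_subset_right, hp Y (mem_filter.1 hY).2⟩
  · refine le_trans ?_ (hM Y (mem_powerset.1 (mem_filter.1 hY).1))
    refine card_le_card_of_injOn (· \ U) (fun Z hZ => ?_) fun Z hZ Z' hZ' h => ?_
    · obtain ⟨hZq, rfl⟩ := mem_filter.1 hZ
      obtain ⟨hZV, hqZ⟩ := mem_filter.1 hZq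
      refine mem_filter.2 ⟨mem_powerset.2 (sdiff_subset_sdiff (mem_powerset.1 hZV) le_rfl), ?_⟩
      rwa [union_comm, sdiff_union_inter]
    · rw [← sdiff_union_inter Z U, ← sdiff_union_inter Z' U, (mem_filter.1 hZ).2,
        (mem_filter.1 hZ').2]
      exact congrArg (· ∪ Y) h

/-- The set `Y` splits `U` into two parts whose sizes differ by less than `D`. -/
def NearlyBalanced (D : ℕ) (Y U : Finset σ) : Prop :=
  |2 * (#(Y ∩ U) : ℤ) - #U| < D

instance (D : ℕ) (Y U : Finset σ) : Decidable (NearlyBalanced D Y U) :=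
  inferInstanceAs (Decidable (_ < _))

theorem nearlyBalanced_inter_iff {D : ℕ} {Y U V : Finset σ} (h : V ⊆ U) :
    NearlyBalanced D (Y ∩ U) V ↔ NearlyBalanced D Y V := by
  rw [NearlyBalanced, inter_assoc, inter_eq_right.2 h, NearlyBalanced]

theorem two_pow_mul_card_nearlyBalanced_powerset_le {U : ℕ → Finset σ} (hU : Monotone U)
    {D t : ℕ} (hcard : ∀ k ≤ t, #(U k) = k * (4 * D ^ 2)) :
    2 ^ t * #{Y ∈ (U t).powerset | ∀ k ≤ t, NearlyBalanced D Y (U k)} ≤ 2 ^ #(U t) := by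
  induction t with
  | zero =>
    rw [pow_zero, one_mul, ← card_powerset]
    exact card_filter_le _ _
  | succ t ih =>
    have hstep : #{Y ∈ (U (t + 1)).powerset | ∀ k ≤ t + 1, NearlyBalanced D Y (U k)} ≤
        D * (2 * D ^ 2).centralBinom *
          #{Y ∈ (U t).powerset | ∀ k ≤ t, NearlyBalanced D Y (U k)} := by
      refine card_filter_powerset_le_mul (fun Y hY k hk => ?_) fun Y hY => ?_
      · exact (nearlyBalanced_inter_iff (hU hk)).2 (hY k (hk.trans t.le_succ))
      · have hB : #(U (t + 1) \ U t) = 2 * (2 * D ^ 2) := by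
          rw [card_sdiff_of_subset (hU t.le_succ), hcard _ le_rfl, hcard _ t.le_succ,
            Nat.succ_mul]
          omega
        refine (card_le_card fun T hT => ?_).trans
          (card_filter_powerset_abs_lt_le _ hB D #Y #(U (t + 1)))
        obtain ⟨hTU, hT⟩ := mem_filter.1 hT
        have hTU := mem_powerset.1 hTU
        have hYT : #((Y ∪ T) ∩ U (t + 1)) = #Y + #T := by
          rw [inter_eq_left.2 (union_subset (hY.trans (hU t.le_succ))
            (hTU.trans sdiff_subset)), card_union_of_disjoint]
          exact disjoint_of_subset_left hY (disjoint_of_subset_right hTU disjoint_sdiff)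
        have hT := hT (t + 1) le_rfl
        rw [NearlyBalanced, hYT] at hT
        exact mem_filter.2 ⟨mem_powerset.2 hTU, by exact_mod_cast hT⟩
    calc 2 ^ (t + 1) * #{Y ∈ (U (t + 1)).powerset | ∀ k ≤ t + 1, NearlyBalanced D Y (U k)}
        ≤ 2 ^ (t + 1) * (D * (2 * D ^ 2).centralBinom *
            #{Y ∈ (U t).powerset | ∀ k ≤ t, NearlyBalanced D Y (U k)}) := by gcongr
      _ = 2 * (D * (2 * D ^ 2).centralBinom) *
            (2 ^ t * #{Y ∈ (U t).powerset | ∀ k ≤ t, NearlyBalanced D Y (U k)}) := by ring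
      _ ≤ 2 ^ (4 * D ^ 2) * 2 ^ #(U t) :=
          Nat.mul_le_mul (two_mul_mul_centralBinom_le D) (ih fun k hk => hcard k (by omega))
      _ = 2 ^ #(U (t + 1)) := by
          rw [← pow_add, hcard _ le_rfl, hcard _ t.le_succ]
          ring_nf

variable [Fintype σ]

theorem two_pow_mul_card_nearlyBalanced_le {U : ℕ → Finset σ} (hU : Monotone U) {D t : ℕ}
    (hcard : ∀ k ≤ t, #(U k) = k * (4 * D ^ 2)) :
    2 ^ t * #{Y : Finset σ | ∀ k ≤ t, NearlyBalanced D Y (U k)} ≤ 2 ^ Fintype.card σ := by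
  have hrestrict : #{Y ∈ (univ : Finset σ).powerset | ∀ k ≤ t, NearlyBalanced D Y (U k)} ≤
      2 ^ #(univ \ U t) * #{Y ∈ (U t).powerset | ∀ k ≤ t, NearlyBalanced D Y (U k)} := by
    refine card_filter_powerset_le_mul (fun Y hY k hk => ?_) fun Y _ => ?_
    · exact (nearlyBalanced_inter_iff (hU hk)).2 (hY k hk)
    · exact (card_filter_le _ _).trans (card_powerset _).le
  rw [powerset_univ] at hrestrict
  calc 2 ^ t * #{Y : Finset σ | ∀ k ≤ t, NearlyBalanced D Y (U k)}
      ≤ 2 ^ t * (2 ^ #(univ \ U t) *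
          #{Y ∈ (U t).powerset | ∀ k ≤ t, NearlyBalanced D Y (U k)}) := by gcongr
    _ = 2 ^ #(univ \ U t) *
          (2 ^ t * #{Y ∈ (U t).powerset | ∀ k ≤ t, NearlyBalanced D Y (U k)}) := by ring
    _ ≤ 2 ^ #(univ \ U t) * 2 ^ #(U t) := by
        gcongr
        exact two_pow_mul_card_nearlyBalanced_powerset_le hU hcard
    _ = 2 ^ Fintype.card σ := by
        rw [← pow_add, card_sdiff_add_card_eq_card (subset_univ _), card_univ]

theorem two_pow_mul_card_le_of_nearlyBalanced_sublevel {key : σ → ℕ}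
    (hkey : Function.Injective key) {D t : ℕ} (ht : t * (4 * D ^ 2) ≤ Fintype.card σ)
    {𝒴 : Finset (Finset σ)} (h𝒴 : ∀ Y ∈ 𝒴, ∀ l, NearlyBalanced D Y ({x | key x < l})) :
    2 ^ t * #𝒴 ≤ 2 ^ Fintype.card σ := by
  choose l hl using fun k : ℕ =>
    exists_card_sublevel_eq hkey (min_le_right (k * (4 * D ^ 2)) (Fintype.card σ))
  have hmono : Monotone fun k => ({x | key x < l k} : Finset σ) := by
    intro k k' hk
    refine subset_of_monotone_of_card_le (S := fun l => ({x | key x < l} : Finset σ))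
      (fun i j hij x hx => ?_) ?_
    · exact (mem_filter_univ _).2 (((mem_filter_univ _).1 hx).trans_le hij)
    · rw [hl, hl]
      gcongr
  calc 2 ^ t * #𝒴 ≤ 2 ^ t * #{Y : Finset σ | ∀ k ≤ t, NearlyBalanced D Y {x | key x < l k}} := by
        gcongr
        exact fun Y hY => (mem_filter_univ _).2 fun k _ => h𝒴 Y hY (l k)
    _ ≤ 2 ^ Fintype.card σ := by
        refine two_pow_mul_card_nearlyBalanced_le hmono fun k hk => ?_
        rw [hl, min_eq_left ((Nat.mul_le_mul_right _ hk).trans ht)]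

end NearlyBalanced

section RankUpperBound

variable {σ K : Type*} [DecidableEq σ] [Field K]

theorem HasCutRankLE.rank_pdMatrix_le {f : MvPolynomial σ K} {V : Finset σ} {s : ℕ}
    (h : HasCutRankLE f V s) (P Q : Finset σ) :
    (pdMatrix f P Q).rank ≤ s * 2 ^ (#(P ∩ V) + #(Q \ V)) := by
  obtain ⟨w, hw, A, B, hA, hB, rfl⟩ := h
  have hterm (u : Fin w) : (pdMatrix (A u * B u) P Q).rank ≤ 2 ^ (#(P ∩ V) + #(Q \ V)) := by
    have hcompl (S : Finset σ) : (↑(S \ V) : Set σ) ⊆ (↑V)ᶜ := fun x hx => by simp_all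
    have hinter (S : Finset σ) : (↑(S ∩ V) : Set σ) ⊆ V := coe_subset.2 inter_subset_right
    have hle := rank_pdMatrix_mul_le disjoint_compl_right (hA u) (hB u) (hinter P) (hinter Q)
      (hcompl P) (hcompl Q)
    rwa [union_comm (P ∩ V), union_comm (Q ∩ V), sdiff_union_inter, sdiff_union_inter] at hle
  calc (pdMatrix (∑ u, A u * B u) P Q).rank
      ≤ ∑ u, (pdMatrix (A u * B u) P Q).rank := by
        rw [pdMatrix_sum]
        exact rank_sum_le _ _
    _ ≤ ∑ _u : Fin w, 2 ^ (#(P ∩ V) + #(Q \ V)) := sum_le_sum fun u _ => hterm u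
    _ = w * 2 ^ (#(P ∩ V) + #(Q \ V)) := by simp
    _ ≤ s * 2 ^ (#(P ∩ V) + #(Q \ V)) := by gcongr

variable [Fintype σ] {Y : Finset σ} {D s : ℕ}

theorem HasCutRankLE.rank_pdMatrix_mul_two_pow_le {f : MvPolynomial σ K} {V : Finset σ}
    (h : HasCutRankLE f V s) (hY : 2 * #Y = Fintype.card σ) (hV : 2 * #(Y ∩ V) + D ≤ #V) :
    (pdMatrix f Y Yᶜ).rank * 2 ^ D ≤ s * 2 ^ #Y := by
  have hcard : #(Y ∩ V) + #(Yᶜ \ V) + D ≤ #Y := by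
    have h₁ := card_union_add_card_inter Y V
    have h₂ := card_add_card_compl (Y ∪ V)
    rw [compl_union, ← sdiff_eq_inter_compl] at h₂
    omega
  calc (pdMatrix f Y Yᶜ).rank * 2 ^ D
      ≤ s * 2 ^ (#(Y ∩ V) + #(Yᶜ \ V)) * 2 ^ D := by
        gcongr
        exact h.rank_pdMatrix_le Y Yᶜ
    _ = s * 2 ^ (#(Y ∩ V) + #(Yᶜ \ V) + D) := by rw [pow_add _ _ D, mul_assoc]
    _ ≤ s * 2 ^ #Y := by gcongr; exact one_le_two

theorem HasCutRankLE.rank_pdMatrix_mul_two_pow_le_of_not_nearlyBalanced {f : MvPolynomial σ K}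
    {V : Finset σ} (h : HasCutRankLE f V s) (hY : 2 * #Y = Fintype.card σ)
    (hV : ¬ NearlyBalanced D Y V) : (pdMatrix f Y Yᶜ).rank * 2 ^ D ≤ s * 2 ^ #Y := by
  rw [NearlyBalanced, not_lt, le_abs] at hV
  rcases hV with hV | hV
  · have hcompl : HasCutRankLE f (Vᶜ : Finset σ) s := by simpa using h.compl
    refine hcompl.rank_pdMatrix_mul_two_pow_le hY ?_
    have h₁ := card_inter_add_card_sdiff Y V
    have h₂ := card_add_card_compl V
    rw [sdiff_eq_inter_compl] at h₁
    omega
  · exact h.rank_pdMatrix_mul_two_pow_le hY (by omega)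

variable {ι : Type*} [Fintype ι]

theorem two_pow_le_card_mul_of_not_nearlyBalanced {p : ι → MvPolynomial σ K} {V : ι → Finset σ}
    (hp : ∀ i, HasCutRankLE (p i) (V i) s) (hY : 2 * #Y = Fintype.card σ)
    (hV : ∀ i, ¬ NearlyBalanced D Y (V i)) (hfull : FullRank (∑ i, p i) Y Yᶜ) :
    2 ^ D ≤ Fintype.card ι * s := by
  have hYc : #Yᶜ = #Y := by
    rw [card_compl]
    omega
  refine Nat.le_of_mul_le_mul_left ?_ (pow_pos two_pos #Y)
  calc 2 ^ #Y * 2 ^ D = (pdMatrix (∑ i, p i) Y Yᶜ).rank * 2 ^ D := by rw [hfull, hYc]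
    _ ≤ (∑ i, (pdMatrix (p i) Y Yᶜ).rank) * 2 ^ D := by
        rw [pdMatrix_sum]
        gcongr
        exact rank_sum_le _ _
    _ ≤ ∑ _i : ι, s * 2 ^ #Y := by
        rw [sum_mul]
        exact sum_le_sum fun i _ =>
          (hp i).rank_pdMatrix_mul_two_pow_le_of_not_nearlyBalanced hY (hV i)
    _ = 2 ^ #Y * (Fintype.card ι * s) := by
        rw [sum_const, card_univ, smul_eq_mul]
        ring

theorem two_pow_le_card_mul_or_of_isROABP {t : ℕ} (hσ : Even (Fintype.card σ))
    (hσ₀ : 0 < Fintype.card σ) (ht : t * (4 * D ^ 2) ≤ Fintype.card σ) {P : ι → ABP K σ}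
    (hP : ∀ i, (P i).IsROABP) (hs : ∀ i, (P i).size ≤ s)
    (hfull : ∀ Y : Finset σ, 2 * #Y = Fintype.card σ → FullRank (∑ i, (P i).poly) Y Yᶜ) :
    2 ^ D ≤ Fintype.card ι * s ∨ 2 ^ t ≤ Fintype.card ι * Fintype.card σ := by
  classical
  choose key hkey hcut using fun i => (hP i).exists_injective_hasCutRankLE
  refine or_iff_not_imp_left.2 fun hlt => two_pow_le_card_mul_card_of_cover hσ hσ₀
    (𝒴 := fun i => {Y | ∀ l, NearlyBalanced D Y {x | key i x < l}})
    (fun i => two_pow_mul_card_le_of_nearlyBalanced_sublevel (hkey i) ht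
      fun Y hY => (mem_filter_univ Y).1 hY) fun Y hY => ?_
  by_contra! hun
  simp only [mem_filter_univ, not_forall] at hun
  choose l hl using hun
  refine hlt (two_pow_le_card_mul_of_not_nearlyBalanced (fun i => ?_) hY hl (hfull Y hY))
  simpa using (hcut i (l i)).mono (hs i)

end RankUpperBound

section Recursion

variable {R S : Type*}

theorem gRec_congr [CommSemiring R] {x x' : ℕ → R} {w w' : ℕ → ℕ → ℕ → R} {i j : ℕ}
    (hx : ∀ p, i ≤ p → p ≤ j → x p = x' p)
    (hw : ∀ a b c, i ≤ a → a ≤ b → b ≤ c → c ≤ j → w a b c = w' a b c) :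
    gRec x w i j = gRec x' w' i j := by
  induction h : j + 1 - i using Nat.strong_induction_on generalizing i j with
  | _ n ih =>
    subst h
    rcases lt_or_ge j i with hji | hij
    · rw [gRec_of_lt _ _ hji, gRec_of_lt _ _ hji]
    have congr_sub : ∀ i' j', i ≤ i' → j' ≤ j → j' + 1 - i' < j + 1 - i →
        gRec x w i' j' = gRec x' w' i' j' := fun i' j' hi hj hlt =>
      ih _ hlt (fun p hp hp' => hx p (by omega) (by omega))
        (fun a b c ha hab hbc hc => hw a b c (by omega) hab hbc (by omega)) rfl
    rw [gRec_of_le _ _ hij, gRec_of_le _ _ hij, hx i le_rfl hij, hx j hij le_rfl,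
      congr_sub (i + 1) (j - 1) (by omega) (by omega) (by omega)]
    congr 1
    refine sum_congr rfl fun k hk => ?_
    simp only [mem_filter, mem_Icc] at hk
    rw [hw i k j le_rfl (by omega) (by omega) le_rfl,
      congr_sub i k (by omega) (by omega) (by omega),
      congr_sub (k + 1) j (by omega) (by omega) (by omega)]

theorem map_gRec [CommSemiring R] [CommSemiring S] (φ : R →+* S) (x : ℕ → R)
    (w : ℕ → ℕ → ℕ → R) (i j : ℕ) :
    φ (gRec x w i j) = gRec (fun p => φ (x p)) (fun a b c => φ (w a b c)) i j := by
  induction h : j + 1 - i using Nat.strong_induction_on generalizing i j with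
  | _ n ih =>
    subst h
    rcases lt_or_ge j i with hji | hij
    · rw [gRec_of_lt _ _ hji, gRec_of_lt _ _ hji, map_one]
    rw [gRec_of_le _ _ hij, gRec_of_le _ _ hij, map_add, map_mul, map_add, map_one, map_mul,
      map_sum, ih _ (by omega) (i + 1) (j - 1) rfl]
    congr 1
    refine sum_congr rfl fun k hk => ?_
    simp only [mem_filter, mem_Icc] at hk
    rw [map_mul, map_mul, ih _ (by omega) i k rfl, ih _ (by omega) (k + 1) j rfl]

theorem gRec_eq_mul_add_gRec [CommRing R] (x : ℕ → R) {w w' : ℕ → ℕ → ℕ → R} {i k j : ℕ}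
    (hk : k ∈ (Icc (i + 1) (j - 2)).filter fun k => Even (k + 1 - i))
    (hw : ∀ a b c, ¬ (a = i ∧ b = k ∧ c = j) → w' a b c = w a b c) :
    gRec x w' i j =
      (w' i k j - w i k j) * (gRec x w i k * gRec x w (k + 1) j) + gRec x w i j := by
  have eq_of_lt (i' j' : ℕ) (hlt : i < i' ∨ j' < j) : gRec x w' i' j' = gRec x w i' j' :=
    gRec_congr (fun _ _ _ => rfl) fun a b c _ _ _ _ => hw a b c (by omega)
  have hij : i ≤ j := by
    simp only [mem_filter, mem_Icc] at hk
    omega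
  have hk_le (k' : ℕ) (hk' : k' ∈ (Icc (i + 1) (j - 2)).filter fun k => Even (k + 1 - i)) :
      i < k' + 1 ∧ k' < j := by
    simp only [mem_filter, mem_Icc] at hk'
    omega
  have hrest : ∑ k' ∈ ((Icc (i + 1) (j - 2)).filter fun k => Even (k + 1 - i)).erase k,
        w' i k' j * gRec x w' i k' * gRec x w' (k' + 1) j =
      ∑ k' ∈ ((Icc (i + 1) (j - 2)).filter fun k => Even (k + 1 - i)).erase k,
        w i k' j * gRec x w i k' * gRec x w (k' + 1) j := by
    refine sum_congr rfl fun k' hk' => ?_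
    obtain ⟨hne, hmem⟩ := mem_erase.1 hk'
    rw [hw i k' j (by simp [hne]), eq_of_lt i k' (.inr (hk_le k' hmem).2),
      eq_of_lt (k' + 1) j (.inl (hk_le k' hmem).1)]
  rw [gRec_of_le x w' hij, gRec_of_le x w hij, ← add_sum_erase _ _ hk, ← add_sum_erase _ _ hk,
    hrest, eq_of_lt (i + 1) (j - 1) (.inl (by omega)), eq_of_lt i k (.inr (hk_le k hk).2),
    eq_of_lt (k + 1) j (.inl (hk_le k hk).1)]
  ring

theorem gRec_of_forall_eq_zero [CommSemiring R] (x : ℕ → R) {w : ℕ → ℕ → ℕ → R} {i j : ℕ}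
    (hij : i ≤ j) (hw : ∀ k, w i k j = 0) :
    gRec x w i j = (1 + x i * x j) * gRec x w (i + 1) (j - 1) := by
  rw [gRec_of_le x w hij, sum_eq_zero fun k _ => by rw [hw k, zero_mul, zero_mul], add_zero]

/-- The polynomial `g_{i,j}` in the variables `x_p`, `p ∈ ℕ`, for the values `w a b c ∈ R` of the
parameters `w_{a,b,c}`. Only the variables with `i ≤ p ≤ j` occur; indexing them by `ℕ` lets
`g_{i,j}` and its subintervals live in one ring. -/
noncomputable def intervalPoly [CommSemiring R] (w : ℕ → ℕ → ℕ → R) (i j : ℕ) : MvPolynomial ℕ R :=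
  gRec X (fun a b c => C (w a b c)) i j

theorem intervalPoly_congr [CommSemiring R] {w w' : ℕ → ℕ → ℕ → R} {i j : ℕ}
    (hw : ∀ a b c, i ≤ a → a ≤ b → b ≤ c → c ≤ j → w a b c = w' a b c) :
    intervalPoly w i j = intervalPoly w' i j :=
  gRec_congr (fun _ _ _ => rfl) fun a b c ha hab hbc hc => by rw [hw a b c ha hab hbc hc]

theorem map_intervalPoly [CommSemiring R] [CommSemiring S] (φ : R →+* S) (w : ℕ → ℕ → ℕ → R)
    (i j : ℕ) : map φ (intervalPoly w i j) = intervalPoly (fun a b c => φ (w a b c)) i j := by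
  simp only [intervalPoly, map_gRec, map_X, map_C]

theorem intervalPoly_mem_supported [CommSemiring R] (w : ℕ → ℕ → ℕ → R) (i j : ℕ) :
    intervalPoly w i j ∈ supported R (Icc i j : Set ℕ) := by
  induction h : j + 1 - i using Nat.strong_induction_on generalizing i j with
  | _ n ih =>
    subst h
    rcases lt_or_ge j i with hji | hij
    · rw [intervalPoly, gRec_of_lt _ _ hji]
      exact one_mem _
    have sub_mem : ∀ i' j', i ≤ i' → j' ≤ j → j' + 1 - i' < j + 1 - i →
        intervalPoly w i' j' ∈ supported R (Icc i j : Set ℕ) := fun i' j' hi hj hlt =>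
      supported_mono (coe_subset.2 (Icc_subset_Icc hi hj)) (ih _ hlt i' j' rfl)
    have X_mem : ∀ p ∈ Icc i j, (X p : MvPolynomial ℕ R) ∈ supported R (Icc i j : Set ℕ) :=
      fun p hp => Algebra.subset_adjoin ⟨p, mem_coe.2 hp, rfl⟩
    rw [intervalPoly, gRec_of_le _ _ hij]
    refine add_mem (mul_mem (add_mem (one_mem _) (mul_mem (X_mem _ (left_mem_Icc.2 hij))
      (X_mem _ (right_mem_Icc.2 hij)))) (sub_mem _ _ (by omega) (by omega) (by omega)))
      (sum_mem fun k hk => ?_)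
    simp only [mem_filter, mem_Icc] at hk
    exact mul_mem (mul_mem (Subalgebra.algebraMap_mem _ _)
      (sub_mem _ _ (by omega) (by omega) (by omega))) (sub_mem _ _ (by omega) (by omega) (by omega))

end Recursion

section Excess

theorem exists_eq_zero_of_pos_of_neg {h : ℕ → ℤ} {a b : ℕ} (hab : a ≤ b)
    (hstep : ∀ k, a ≤ k → h k - 1 ≤ h (k + 1)) (ha : 0 < h a) (hb : h b < 0) :
    ∃ k, a < k ∧ k < b ∧ h k = 0 := by
  induction b, hab using Nat.le_induction with
  | base => omega
  | succ b hab ih =>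
    rcases lt_trichotomy (h b) 0 with hneg | hzero | hpos
    · obtain ⟨k, hak, hkb, hk⟩ := ih hneg
      exact ⟨k, hak, by omega, hk⟩
    · exact ⟨b, lt_of_le_of_ne hab (by rintro rfl; omega), by omega, hzero⟩
    · have := hstep b hab
      omega

/-- The number of elements of the interval `[i, j]` that lie in `Y` minus the number of those that
do not, so that `Y` cuts `[i, j]` into halves exactly when the excess vanishes. -/
def excess (Y : Finset ℕ) (i j : ℕ) : ℤ :=
  ∑ p ∈ Icc i j, if p ∈ Y then 1 else -1

theorem excess_eq_card_sub_card (Y : Finset ℕ) (i j : ℕ) :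
    excess Y i j = #(Icc i j ∩ Y) - #(Icc i j \ Y) := by
  rw [excess, sum_ite, filter_mem_eq_inter, filter_notMem_eq_sdiff]
  simp [sub_eq_add_neg]

theorem card_inter_eq_card_sdiff_of_excess_eq_zero {Y : Finset ℕ} {i j : ℕ}
    (h : excess Y i j = 0) : #(Icc i j ∩ Y) = #(Icc i j \ Y) := by
  rw [excess_eq_card_sub_card] at h
  omega

theorem even_of_excess_eq_zero {Y : Finset ℕ} {i j : ℕ} (h : excess Y i j = 0) :
    Even (j + 1 - i) := by
  rw [← Nat.card_Icc, ← card_inter_add_card_sdiff (Icc i j) Y,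
    ← card_inter_eq_card_sdiff_of_excess_eq_zero h]
  exact Even.add_self _

theorem excess_append (Y : Finset ℕ) {i k j : ℕ} (hik : i ≤ k + 1) (hkj : k ≤ j) :
    excess Y i j = excess Y i k + excess Y (k + 1) j := by
  have hunion : Icc i j = Icc i k ∪ Icc (k + 1) j := by
    ext p
    simp only [mem_union, mem_Icc]
    omega
  rw [excess, hunion, sum_union (disjoint_left.2 fun p => by simp only [mem_Icc]; omega)]
  rfl

theorem excess_self (Y : Finset ℕ) (i : ℕ) : excess Y i i = if i ∈ Y then 1 else -1 := by
  simp [excess]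

theorem excess_pred_add_excess_self (Y : Finset ℕ) {i j : ℕ} (hij : i < j) :
    excess Y i j = excess Y i (j - 1) + excess Y j j := by
  obtain ⟨j, rfl⟩ : ∃ j', j = j' + 1 := ⟨j - 1, by omega⟩
  exact excess_append Y (by omega) (by omega)

theorem exists_excess_eq_zero {Y : Finset ℕ} {i j : ℕ} (hij : i < j) (h : excess Y i j = 0)
    (hY : i ∈ Y ↔ j ∈ Y) : ∃ k, i < k ∧ k < j - 1 ∧ excess Y i k = 0 := by
  have hself : excess Y i i * excess Y i i = 1 := by
    rw [excess_self]
    split_ifs <;> rfl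
  have hend : excess Y i (j - 1) = -excess Y i i := by
    have hlast := excess_pred_add_excess_self Y hij
    rw [excess_self] at hlast ⊢
    simp only [hY]
    omega
  -- Normalised by the sign of its first step, the walk starts at `1` and reaches `-1` at `j - 1`.
  obtain ⟨k, hik, hkj, hk⟩ := exists_eq_zero_of_pos_of_neg
    (h := fun k => excess Y i i * excess Y i k) (show i ≤ j - 1 by omega)
    (fun k hk => by
      simp only [excess_append Y (show i ≤ k + 1 by omega) k.le_succ, excess_self]
      split_ifs <;> omega)
    (by omega) (by rw [hend, mul_neg]; omega)
  exact ⟨k, hik, hkj, (mul_eq_zero.1 hk).resolve_left fun h0 => by simp [h0] at hself⟩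

end Excess

section FullRankInterval

variable {K : Type*} [Field K] {Y : Finset ℕ} {i k j : ℕ}

theorem FullRank.intervalPoly_mul_intervalPoly (hik : i ≤ k) (hkj : k ≤ j)
    {w₁ w₂ : ℕ → ℕ → ℕ → K}
    (h₁ : FullRank (intervalPoly w₁ i k) (Icc i k ∩ Y) (Icc i k \ Y))
    (h₂ : FullRank (intervalPoly w₂ (k + 1) j) (Icc (k + 1) j ∩ Y) (Icc (k + 1) j \ Y)) :
    FullRank (intervalPoly w₁ i k * intervalPoly w₂ (k + 1) j) (Icc i j ∩ Y) (Icc i j \ Y) := by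
  have hdisj : Disjoint (Icc i k : Set ℕ) (Icc (k + 1) j) :=
    disjoint_coe.2 <| disjoint_left.2 fun p => by simp only [mem_Icc]; omega
  have hunion : Icc i j = Icc i k ∪ Icc (k + 1) j := by
    ext p
    simp only [mem_union, mem_Icc]
    omega
  rw [hunion, union_inter_distrib_right, union_sdiff_distrib]
  exact FullRank.mul hdisj (intervalPoly_mem_supported w₁ i k)
    (intervalPoly_mem_supported w₂ (k + 1) j) (coe_subset.2 inter_subset_left)
    (coe_subset.2 sdiff_subset) (coe_subset.2 inter_subset_left) (coe_subset.2 sdiff_subset) h₁ h₂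

theorem FullRank.exists_intervalPoly_of_split [Infinite K] (hik : i < k) (hkj : k < j - 1)
    (hk : excess Y i k = 0) (hj : excess Y (k + 1) j = 0) {w₁ w₂ : ℕ → ℕ → ℕ → K}
    (h₁ : FullRank (intervalPoly w₁ i k) (Icc i k ∩ Y) (Icc i k \ Y))
    (h₂ : FullRank (intervalPoly w₂ (k + 1) j) (Icc (k + 1) j ∩ Y) (Icc (k + 1) j \ Y)) :
    ∃ w : ℕ → ℕ → ℕ → K, FullRank (intervalPoly w i j) (Icc i j ∩ Y) (Icc i j \ Y) := by
  let w : ℕ → ℕ → ℕ → K := fun a b c => if c ≤ k then w₁ a b c else w₂ a b c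
  have hw₁ : intervalPoly w i k = intervalPoly w₁ i k :=
    intervalPoly_congr fun a b c _ _ _ hc => if_pos hc
  have hw₂ : intervalPoly w (k + 1) j = intervalPoly w₂ (k + 1) j :=
    intervalPoly_congr fun a b c ha _ _ _ => if_neg (by omega)
  have hprod : FullRank (intervalPoly w i k * intervalPoly w (k + 1) j)
      (Icc i j ∩ Y) (Icc i j \ Y) := by
    rw [hw₁, hw₂]
    exact h₁.intervalPoly_mul_intervalPoly hik.le (by omega) h₂
  have hbal : #(Icc i j ∩ Y) = #(Icc i j \ Y) := by
    apply card_inter_eq_card_sdiff_of_excess_eq_zero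
    rw [excess_append Y (k := k) (by omega) (by omega), hk, hj, add_zero]
  obtain ⟨z, hz⟩ := hprod.exists_C_mul_add hbal (intervalPoly w i j)
  refine ⟨fun a b c => if a = i ∧ b = k ∧ c = j then w i k j + z else w a b c, ?_⟩
  rwa [intervalPoly, gRec_eq_mul_add_gRec (w := fun a b c => C (w a b c)) (k := k) X
    (mem_filter.2 ⟨mem_Icc.2 (by omega), even_of_excess_eq_zero hk⟩)
    (fun a b c h => by rw [if_neg h]), if_pos ⟨rfl, rfl, rfl⟩, C_add, add_sub_cancel_left]

theorem fullRank_one_add_X_mul_X_of_mem_iff_notMem (hij : i ≠ j) (hY : i ∈ Y ↔ j ∉ Y) :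
    FullRank (1 + X i * X j : MvPolynomial ℕ K) ({i, j} ∩ Y) ({i, j} \ Y) := by
  by_cases hi : i ∈ Y
  · rw [show {i, j} ∩ Y = {i} by grind, show {i, j} \ Y = {j} by grind]
    exact fullRank_one_add_X_mul_X hij
  · rw [show {i, j} ∩ Y = {j} by grind, show {i, j} \ Y = {i} by grind, mul_comm (X i)]
    exact fullRank_one_add_X_mul_X hij.symm

theorem FullRank.exists_intervalPoly_of_ends (hij : i < j) (hY : i ∈ Y ↔ j ∉ Y)
    {w₀ : ℕ → ℕ → ℕ → K} (h₀ : FullRank (intervalPoly w₀ (i + 1) (j - 1))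
      (Icc (i + 1) (j - 1) ∩ Y) (Icc (i + 1) (j - 1) \ Y)) :
    ∃ w : ℕ → ℕ → ℕ → K, FullRank (intervalPoly w i j) (Icc i j ∩ Y) (Icc i j \ Y) := by
  let w : ℕ → ℕ → ℕ → K := fun a b c => if a = i then 0 else w₀ a b c
  have hw₀ : intervalPoly w (i + 1) (j - 1) = intervalPoly w₀ (i + 1) (j - 1) :=
    intervalPoly_congr fun a b c ha _ _ _ => if_neg (by omega)
  have hw : intervalPoly w i j = (1 + X i * X j) * intervalPoly w₀ (i + 1) (j - 1) := by
    rw [← hw₀, intervalPoly, gRec_of_forall_eq_zero X hij.le fun k => by simp [w], intervalPoly]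
  have hpair : (1 + X i * X j : MvPolynomial ℕ K) ∈ supported K (({i, j} : Finset ℕ) : Set ℕ) :=
    add_mem (one_mem _) (mul_mem (Algebra.subset_adjoin ⟨i, by simp, rfl⟩)
      (Algebra.subset_adjoin ⟨j, by simp, rfl⟩))
  have hdisj : Disjoint (({i, j} : Finset ℕ) : Set ℕ) (Icc (i + 1) (j - 1) : Finset ℕ) :=
    disjoint_coe.2 <| disjoint_left.2 fun p => by
      simp only [mem_Icc, mem_insert, mem_singleton]
      omega
  have hunion : Icc i j = {i, j} ∪ Icc (i + 1) (j - 1) := by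
    ext p
    simp only [mem_Icc, mem_insert, mem_singleton, mem_union]
    omega
  refine ⟨w, ?_⟩
  rw [hw, hunion, union_inter_distrib_right, union_sdiff_distrib]
  exact FullRank.mul hdisj hpair (intervalPoly_mem_supported w₀ _ _)
    (coe_subset.2 inter_subset_left) (coe_subset.2 sdiff_subset) (coe_subset.2 inter_subset_left)
    (coe_subset.2 sdiff_subset) (fullRank_one_add_X_mul_X_of_mem_iff_notMem hij.ne hY) h₀

theorem exists_fullRank_intervalPoly [Infinite K] (h : excess Y i j = 0) :
    ∃ w : ℕ → ℕ → ℕ → K, FullRank (intervalPoly w i j) (Icc i j ∩ Y) (Icc i j \ Y) := by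
  induction hn : j + 1 - i using Nat.strong_induction_on generalizing i j with
  | _ n ih =>
    subst hn
    rcases lt_trichotomy i j with hij | rfl | hji
    · by_cases hY : i ∈ Y ↔ j ∈ Y
      · obtain ⟨k, hik, hkj, hk⟩ := exists_excess_eq_zero hij h hY
        have hj : excess Y (k + 1) j = 0 := by
          rwa [excess_append Y (k := k) (by omega) (by omega), hk, zero_add] at h
        obtain ⟨w₁, h₁⟩ := ih _ (by omega) hk rfl
        obtain ⟨w₂, h₂⟩ := ih _ (by omega) hj rfl
        exact h₁.exists_intervalPoly_of_split hik hkj hk hj h₂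
      · have hinner : excess Y (i + 1) (j - 1) = 0 := by
          have hcancel : excess Y i i + excess Y j j = 0 := by
            rw [excess_self, excess_self]
            split_ifs <;> tauto
          rw [excess_pred_add_excess_self Y hij,
            excess_append Y (k := i) (by omega) (by omega)] at h
          omega
        obtain ⟨w₀, h₀⟩ := ih _ (by omega) hinner rfl
        exact h₀.exists_intervalPoly_of_ends hij (by tauto)
    · simpa using even_of_excess_eq_zero h
    · refine ⟨0, ?_⟩
      rw [intervalPoly, gRec_of_lt _ _ hji, Icc_eq_empty_of_lt hji, empty_inter, empty_sdiff]
      exact fullRank_one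

end FullRankInterval

section HardPoly

variable (F : Type*) [Field F] (N : ℕ)

/-- The parameter `w_{i,k,j}` as an element of the polynomial ring `F[W]`, whose field of fractions
is `RatField F N`, and `0` unless `i, k, j ∈ [N]`. Unlike elements of `RatField F N`, polynomials
in the parameters can be specialized. -/
noncomputable def genericParam (i k j : ℕ) : MvPolynomial (Idx N × Idx N × Idx N) F :=
  if h : i ∈ Icc 1 N ∧ k ∈ Icc 1 N ∧ j ∈ Icc 1 N then
    X (⟨i, h.1⟩, ⟨k, h.2.1⟩, ⟨j, h.2.2⟩) else 0

theorem wVar_eq_C_genericParam (i k j : ℕ) :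
    wVar F N i k j = C (algebraMap _ (RatField F N) (genericParam F N i k j)) := by
  unfold wVar genericParam
  split_ifs <;> simp

theorem rename_hardPoly : rename Subtype.val (hardPoly F N) =
    map (algebraMap _ (RatField F N)) (intervalPoly (genericParam F N) 1 N) := by
  have hmap := map_gRec (rename (R := RatField F N) (Subtype.val : Idx N → ℕ)).toRingHom
    (xVar F N) (wVar F N) 1 N
  rw [map_intervalPoly]
  refine hmap.trans (gRec_congr (fun p hp hpN => ?_) fun a b c _ _ _ _ => ?_)
  · rw [xVar, dif_pos (mem_Icc.2 ⟨hp, hpN⟩)]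
    exact rename_X _ _
  · rw [wVar_eq_C_genericParam]
    exact rename_C _ _

theorem map_aeval_intervalPoly_genericParam {L : Type*} [CommSemiring L] [Algebra F L]
    (w : ℕ → ℕ → ℕ → L) :
    map (aeval fun x : Idx N × Idx N × Idx N => w x.1 x.2.1 x.2.2).toRingHom
      (intervalPoly (genericParam F N) 1 N) = intervalPoly w 1 N := by
  rw [map_intervalPoly]
  refine intervalPoly_congr fun a b c ha hab hbc hc => ?_
  rw [genericParam, dif_pos (by simp only [mem_Icc]; omega)]
  exact aeval_X _ _

theorem fullRank_hardPoly {Y : Finset (Idx N)} (hY : 2 * #Y = N) :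
    FullRank (hardPoly F N) Y Yᶜ := by
  let v : Idx N ↪ ℕ := Function.Embedding.subtype _
  have hinter : Icc 1 N ∩ Y.map v = Y.map v := by
    rw [inter_eq_right]
    exact fun p hp => property_of_mem_map_subtype Y hp
  have hsdiff : Icc 1 N \ Y.map v = Yᶜ.map v := by
    ext p
    simp only [v, mem_sdiff, mem_map, mem_compl, Function.Embedding.subtype_apply, Subtype.exists]
    grind
  have hcard : #(Y.map v) = #(Yᶜ.map v) := by
    rw [card_map, card_map, card_compl, Fintype.card_coe, Nat.card_Icc]
    omega
  have hexcess : excess (Y.map v) 1 N = 0 := by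
    rw [excess_eq_card_sub_card, hinter, hsdiff, hcard, sub_self]
  obtain ⟨w, hw⟩ := exists_fullRank_intervalPoly (K := AlgebraicClosure F) hexcess
  rw [hinter, hsdiff, ← map_aeval_intervalPoly_genericParam F N w] at hw
  rw [← fullRank_rename_iff v]
  exact (rename_hardPoly F N).symm ▸
    hw.map_of_injective hcard (IsFractionRing.injective _ (RatField F N))

end HardPoly

section Bound

theorem exists_three_le_cube_le_lt {n : ℕ} (hn : 12 ^ 3 ≤ n) :
    ∃ k, 3 ≤ k ∧ (4 * k) ^ 3 ≤ n ∧ n < (4 * (k + 1)) ^ 3 := by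
  have hle : Nat.nthRoot 3 n ^ 3 ≤ n := Nat.pow_nthRoot_le (.inl (by norm_num))
  have hlt : n < (Nat.nthRoot 3 n + 1) ^ 3 := Nat.lt_pow_nthRoot_add_one (by norm_num) n
  have hroot : 12 < Nat.nthRoot 3 n + 1 := lt_of_pow_lt_pow_left' 3 (hn.trans_lt hlt)
  exact ⟨Nat.nthRoot 3 n / 4, by omega, (Nat.pow_le_pow_left (by omega) 3).trans hle,
    hlt.trans_le (Nat.pow_le_pow_left (by omega) 3)⟩

variable {σ K ι : Type*} [DecidableEq σ] [Field K] [Fintype σ] [Fintype ι]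

theorem two_pow_le_card_mul_of_isROABP {k s : ℕ} (hk : 3 ≤ k) (hσ : Even (Fintype.card σ))
    (hle : (4 * k) ^ 3 ≤ Fintype.card σ) (hlt : Fintype.card σ < (4 * (k + 1)) ^ 3)
    {P : ι → ABP K σ} (hP : ∀ i, (P i).IsROABP) (hs : ∀ i, (P i).size ≤ s)
    (hfull : ∀ Y : Finset σ, 2 * #Y = Fintype.card σ → FullRank (∑ i, (P i).poly) Y Yᶜ) :
    2 ^ (k + 1) ≤ Fintype.card ι * s := by
  have ht : (4 * k + 7) * (4 * (k + 1) ^ 2) ≤ Fintype.card σ := by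
    refine le_trans ?_ hle
    nlinarith [Nat.mul_le_mul hk hk, Nat.mul_le_mul_left (k ^ 2) hk]
  have hσ_le : Fintype.card σ ≤ 2 ^ (3 * k + 6) :=
    calc Fintype.card σ ≤ (4 * (k + 1)) ^ 3 := hlt.le
      _ ≤ (4 * 2 ^ k) ^ 3 := by gcongr; exact Nat.lt_two_pow_self
      _ = 2 ^ (3 * k + 6) := by ring
  rcases two_pow_le_card_mul_or_of_isROABP hσ (lt_of_lt_of_le (by positivity) hle) ht hP hs hfull
    with h | h
  · exact h
  have hι : 2 ^ (k + 1) ≤ Fintype.card ι := by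
    refine Nat.le_of_mul_le_mul_right (c := 2 ^ (3 * k + 6)) ?_ (by positivity)
    rw [← pow_add, show k + 1 + (3 * k + 6) = 4 * k + 7 by ring]
    exact h.trans (Nat.mul_le_mul_left _ hσ_le)
  obtain ⟨i⟩ : Nonempty ι := Fintype.card_pos_iff.1 (lt_of_lt_of_le (by positivity) hι)
  exact hι.trans (Nat.le_mul_of_pos_right _ ((P i).size_pos.trans_le (hs i)))

theorem rpow_one_third_div_four_le {n k : ℕ} (h : n < (4 * (k + 1)) ^ 3) :
    (n : ℝ) ^ ((1 : ℝ) / 3) / 4 ≤ (k + 1 : ℕ) := by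
  have hroot : (n : ℝ) ^ ((1 : ℝ) / 3) ≤ (4 * (k + 1) : ℕ) := by
    rw [one_div, Real.rpow_inv_le_iff_of_pos (by positivity) (by positivity) (by norm_num)]
    exact_mod_cast h.le
  push_cast at hroot ⊢
  linarith

theorem two_rpow_div_rpow_logb_le {N m s : ℕ} (hN : 2 ≤ N)
    (h : (2 : ℝ) ^ ((N : ℝ) ^ ((1 : ℝ) / 3) / 4) ≤ m * s) :
    (2 : ℝ) ^ (1 / 4 * (N : ℝ) ^ ((1 : ℝ) / 5)) / (s : ℝ) ^ (1 * Real.logb 2 (N : ℝ)) ≤ m := by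
  have hN' : (2 : ℝ) ≤ N := by exact_mod_cast hN
  have hs : 1 ≤ s := Nat.one_le_iff_ne_zero.2 fun hs =>
    h.not_gt (by rw [hs, Nat.cast_zero, mul_zero]; positivity)
  have hlog : 1 ≤ Real.logb 2 (N : ℝ) := by
    rwa [Real.le_logb_iff_rpow_le one_lt_two (by positivity), Real.rpow_one]
  rw [one_mul, div_le_iff₀ (by positivity), one_div_mul_eq_div]
  calc (2 : ℝ) ^ ((N : ℝ) ^ ((1 : ℝ) / 5) / 4) ≤ (2 : ℝ) ^ ((N : ℝ) ^ ((1 : ℝ) / 3) / 4) := by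
        gcongr <;> linarith
    _ ≤ m * s := h
    _ = m * (s : ℝ) ^ (1 : ℝ) := by rw [Real.rpow_one]
    _ ≤ m * (s : ℝ) ^ Real.logb 2 (N : ℝ) := by
        gcongr
        exact_mod_cast hs

end Bound

end ROABP

theorem theorem1_general {σ K ι : Type*} [DecidableEq σ] [Field K] [Fintype σ] [Fintype ι]
    (hσ : Even (Fintype.card σ)) (hσ₀ : 12 ^ 3 ≤ Fintype.card σ) {f : MvPolynomial σ K}
    (hf : ∀ Y : Finset σ, 2 * Y.card = Fintype.card σ → ROABP.FullRank f Y Yᶜ)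
    {s : ℕ} {P : ι → ROABP.ABP K σ} (hP : ∀ i, (P i).IsROABP) (hs : ∀ i, (P i).size ≤ s)
    (hsum : f = ∑ i, (P i).poly) :
    (2 : ℝ) ^ ((Fintype.card σ : ℝ) ^ ((1 : ℝ) / 3) / 4) ≤ Fintype.card ι * s := by
  obtain ⟨k, hk, hle, hlt⟩ := ROABP.exists_three_le_cube_le_lt hσ₀
  calc (2 : ℝ) ^ ((Fintype.card σ : ℝ) ^ ((1 : ℝ) / 3) / 4) ≤ (2 : ℝ) ^ ((k + 1 : ℕ) : ℝ) :=
        Real.rpow_le_rpow_of_exponent_le one_le_two (ROABP.rpow_one_third_div_four_le hlt)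
    _ = (2 ^ (k + 1) : ℕ) := by rw [Real.rpow_natCast, Nat.cast_pow, Nat.cast_ofNat]
    _ ≤ Fintype.card ι * s := by
        exact_mod_cast ROABP.two_pow_le_card_mul_of_isROABP hk hσ hle hlt hP hs (hsum ▸ hf)

theorem theorem1 :
    ∃ ε c : ℝ, 0 < ε ∧ 0 < c ∧ ∃ N₀ : ℕ,
      ∀ (F : Type*) [Field F] (N : ℕ), N₀ ≤ N → Even N →
        ∀ (m s : ℕ) (P : Fin m → ROABP.ABP (ROABP.RatField F N) (ROABP.Idx N)),
          (∀ i, (P i).IsROABP) → (∀ i, (P i).size ≤ s) →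
          ROABP.hardPoly F N = ∑ i, (P i).poly →
          (2 : ℝ) ^ (ε * (N : ℝ) ^ ((1 : ℝ) / 5)) / (s : ℝ) ^ (c * Real.logb 2 (N : ℝ)) ≤ (m : ℝ) := by
  refine ⟨1 / 4, 1, by norm_num, one_pos, 12 ^ 3, fun F _ N hN₀ hN m s P hP hs hsum => ?_⟩
  have hcard : Fintype.card (ROABP.Idx N) = N := by simp
  have hbound := theorem1_general (by rwa [hcard]) (by rwa [hcard])
    (fun Y hY => ROABP.fullRank_hardPoly F N (hY.trans hcard)) hP hs hsum
  rw [hcard, Fintype.card_fin] at hbound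
  exact ROABP.two_rpow_div_rpow_logb_le (le_trans (by norm_num) hN₀) hbound
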